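/- **Setting.** Let $K\ge 2$. Arm $i\in\{1,\dots,K\}$ has a rarity index $\alpha_i>0$ and finitely many (at least one) rescaled nonzero reward values $a_{ij}\in(0,B_i]$ with weights $p_{ij}>0$: at rarity $\gamma$ it pays $a_{ij}\gamma^{-\alpha_i}$ with probability $p_{ij}\gamma^{\alpha_i}$, and $0$ otherwise. Let $\mu_i=\sum_j a_{ij}p_{ij}$, $\sigma_i^2=\sum_j a_{ij}^2p_{ij}$, $\alpha_{\max}=\max_i\alpha_i$, and $M=\{i\neq1:\alpha_i=\alpha_{\max}\}$. Assume $\mu_1>\mu_2>\mu_i$ for all $i\ge3$. If $B_i$ is not among the $a_{ij}$, add it as a further point $j$ with $p_{ij}=0$. For nonnegative $\tilde p_i=(\tilde p_{ij})_j$ put $D(p_i,\tilde p_i)=\sum_j\big[p_{ij}\log\frac{p_{ij}}{\tilde p_{ij}}+\tilde p_{ij}-p_{ij}\big]$, where a term with $p_{ij}=0$ is $\tilde p_{ij}$ and a term with $p_{ij}>0=\tilde p_{ij}$ is $+\infty$. For $\gamma>0$, optimal weights $w^*=w^*(\gamma)$ are a solution of $$\max_{w\in\Sigma_K}\ \min_{i\ne1}\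 \inf\Big\{w_1\gamma^{\alpha_1}D(p_1,\tilde p_1)+w_i\gamma^{\alpha_i}D(p_i,\tilde p_i)\ :\ \sum_ja_{ij}\tilde p_{ij}\ge\sum_ja_{1j}\tilde p_{1j}\Big\},$$ where $\Sigma_K$ is the probability simplex. Such weights exist, and the assertions below hold for every choice of them. $u=\Theta(v)$ means $0<\liminf_{\gamma\to0^+}u/v\le\limsup_{\gamma\to0^+}u/v<\infty$. **Parameters.** For $y\ge0$ let $x(y)=\sum_j\frac{a_{1j}p_{1j}}{1+ya_{1j}}$. For $x\ge\mu_i$ let $r=C_i(x)\in[0,1/B_i]$ be the solution of $\sum_j\frac{a_{ij}p_{ij}}{1-ra_{ij}}=x$, or $C_i(x)=1/B_i$ if the left side is still at most $x$ at $r=1/B_i$ (sums over $p_{ij}>0$); it is unique. Write $y=g_i(r)$ when $y\ge0$, $x(y)\ge\mu_i$ and $r=C_i(x(y))$, and then put $$D_i(x)=\sum_jp_{ij}\log(1-C_i(x)a_{ij})+C_i(x)\,x,\qquad f_i=\sum_jp_{1j}\log(1+ya_{1j})+\frac yr\sum_jp_{ij}\log(1-ra_{ij}),\qquad h_i=\frac{\sum_jp_{1j}\log(1+ya_{1j})-y\,x(y)}{D_i(x(y))},$$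 where $f_i=\sum_jp_{1j}\log(1+ya_{1j})-y\mu_i$ if $r=0$. A *profile* is a family $(r_i,y_i)_{i\neq1}$ with $y_i=g_i(r_i)$ and all the values $f_i$ equal. There is exactly one profile with $r_2=0$, denoted $\xi$; let $E$ be its common value of $f_i$, and $\zeta=\sum_{k\in M}h_k$, evaluated at $\xi$. A profile is *balanced* if $\sum_{k\in M}h_k=1$. For a profile put $\Lambda_1=\big(1+\sum_{k\in M}y_k/r_k\big)^{-1}$ and $\Lambda_i=\Lambda_1\,y_i/r_i$ for $i\ne1$. **Theorem.** As $\gamma\to0^+$: *Case 1 (the best arm is not the rarest, $\alpha_1\ne\alpha_{\max}$).* $w_1^*=\Theta(\gamma^{(\alpha_{\max}-\alpha_1)/2})$ and $w_i^*=\Theta(\gamma^{\alpha_{\max}-\alpha_i})$ for $i\ne1$. With $A_i=C_i(\mu_1)$ and $D_i=D_i(\mu_1)$, $w_i^*/\gamma^{\alpha_{\max}-\alpha_i}\to L_i:=\frac{1/D_i}{\sum_{k\in M}1/D_k}$ for $i\neq1$ and $w_1^*/\gamma^{(\alpha_{\max}-\alpha_1)/2}\to\sqrt{\tfrac{\sigma_1^2}2\sum_{k\in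 M}A_k^2L_k^2/D_k}$. *Case 2 (the best arm is uniquely the rarest, $\alpha_1=\alpha_{\max}>\alpha_i$ for $i\ne1$).* $w_2^*=\Theta(\gamma^{(\alpha_{\max}-\alpha_2)/2})$ and $w_i^*=\Theta(\gamma^{\alpha_{\max}-\alpha_i})$ for $i\neq2$. With the profile $\xi$, $w_i^*/\gamma^{\alpha_{\max}-\alpha_i}\to\Lambda_i$ for $i\ne2$ and $w_2^*/\gamma^{(\alpha_{\max}-\alpha_2)/2}\to\Lambda_1y_2\sqrt{(1-\zeta)\sigma_2^2/(2E)}$ (here $\zeta=0$ and $\Lambda_1=1$). *Case 3 (the best and second best arms only are the rarest, $\alpha_1=\alpha_2=\alpha_{\max}>\alpha_i$ for $i\ge3$).* $w_i^*=\Theta(\gamma^{\alpha_{\max}-\alpha_i})$ for all $i$. There is exactly one balanced profile, and with it $w_i^*/\gamma^{\alpha_{\max}-\alpha_i}\to\Lambda_i$ for all $i$. *Cases 4 and 5 (the best arm is the rarest but not uniquely: $\alpha_1=\alpha_k=\alpha_{\max}$ for some $k\ge3$, and $\alpha_2<\alpha_{\max}$).* *Case 4, $\zeta>1$.* $w_i^*=\Theta(\gamma^{\alpha_{\max}-\alpha_i})$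 for all $i$. There is exactly one balanced profile, and with it $w_i^*/\gamma^{\alpha_{\max}-\alpha_i}\to\Lambda_i$ for all $i$. *Case 5, $\zeta\le1$.* $w_i^*=\Theta(\gamma^{\alpha_{\max}-\alpha_i})$ for $i\ne2$, and, if $\zeta<1$, $w_2^*=\Theta(\gamma^{(\alpha_{\max}-\alpha_2)/2})$. With the profile $\xi$, $w_i^*/\gamma^{\alpha_{\max}-\alpha_i}\to\Lambda_i$ for $i\ne2$ and $w_2^*/\gamma^{(\alpha_{\max}-\alpha_2)/2}\to\Lambda_1y_2\sqrt{(1-\zeta)\sigma_2^2/(2E)}$, which is positive for $\zeta<1$ and zero for $\zeta=1$. -/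

import Mathlib

open Filter Topology Asymptotics

/-- The rescaled data of one arm with rare rewards.  At rarity `γ` and with rarity index `α`, the
arm pays `a * γ ^ (-α)` with probability `p a * γ ^ α` for each of the finitely many points
`a ∈ supp`, and pays zero otherwise; `B * γ ^ (-α)` is the known upper bound on its rewards. -/
structure RareArm where
  /-- The rescaled nonzero reward values `a_{ij}`. -/
  supp : Finset ℝ
  /-- The rescaled probabilities `p_{ij}`, as a function of the reward value. -/
  p : ℝ → ℝ
  /-- The rescaled upper bound on the rewards. -/
  B : ℝ
  supp_nonempty : supp.Nonempty
  supp_pos : ∀ a ∈ supp, 0 < a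
  supp_le : ∀ a ∈ supp, a ≤ B
  p_pos : ∀ a ∈ supp, 0 < p a
  p_off : ∀ a, a ∉ supp → p a = 0

namespace RareArm

/-- The mean reward `∑ a p(a)`, which does not depend on `γ`. -/
noncomputable def mean (A : RareArm) : ℝ := ∑ a ∈ A.supp, a * A.p a

/-- The second moment `∑ a² p(a)`. -/
noncomputable def secondMoment (A : RareArm) : ℝ := ∑ a ∈ A.supp, a ^ 2 * A.p a

/-- The support extended by the upper bound `B` (nothing is added if `B` is in the support). -/
noncomputable def extSupp (A : RareArm) : Finset ℝ := insert A.B A.supp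

/-- The alternatives `q` for the weights `p`: nonnegative on the extended support, and positive on
the support (otherwise the divergence below is `+∞`).  Only the values of `q` on the extended
support matter. -/
def IsAlternative (A : RareArm) (q : ℝ → ℝ) : Prop :=
  (∀ a ∈ A.extSupp, 0 ≤ q a) ∧ ∀ a ∈ A.supp, 0 < q a

/-- The mean of an alternative. -/
noncomputable def altMean (A : RareArm) (q : ℝ → ℝ) : ℝ := ∑ a ∈ A.extSupp, a * q a

/-- The Poisson approximation `∑ (p log (p / q) + q - p)` of the Kullback-Leibler divergence, over
the extended support.  A point of mass `p a = 0` contributes `q a`. -/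
noncomputable def poissonKL (A : RareArm) (q : ℝ → ℝ) : ℝ :=
  ∑ a ∈ A.extSupp, (A.p a * Real.log (A.p a / q a) + (q a - A.p a))

/-- `∑ p(a) log (1 + y a)`. -/
noncomputable def logUp (A : RareArm) (y : ℝ) : ℝ := ∑ a ∈ A.supp, A.p a * Real.log (1 + y * a)

/-- `∑ p(a) log (1 - r a)`. -/
noncomputable def logDown (A : RareArm) (r : ℝ) : ℝ := ∑ a ∈ A.supp, A.p a * Real.log (1 - r * a)

/-- `∑ a p(a) / (1 + y a)`: the mean after tilting down with parameter `y`. -/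
noncomputable def meanLow (A : RareArm) (y : ℝ) : ℝ := ∑ a ∈ A.supp, a * A.p a / (1 + y * a)

/-- `∑ a p(a) / (1 - r a)`: the mean, without extra mass at `B`, after tilting up with
parameter `r`. -/
noncomputable def meanHigh (A : RareArm) (r : ℝ) : ℝ := ∑ a ∈ A.supp, a * A.p a / (1 - r * a)

/-- `r` is the tilting parameter that raises the mean of the arm to `x`: either
`∑ a p(a) / (1 - r a) = x`, or `r` has reached its largest value `1 / B`, and the missing part
`x - ∑ a p(a) / (1 - r a) ≥ 0` of the mean comes from mass put at the point `B` (which is possible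
only if `B` is not in the support). -/
def IsRaise (A : RareArm) (r x : ℝ) : Prop :=
  0 ≤ r ∧ (∀ a ∈ A.supp, r * a < 1) ∧
    ((r * A.B ≤ 1 ∧ A.meanHigh r = x) ∨ (r * A.B = 1 ∧ A.meanHigh r ≤ x))

end RareArm

/-- A bandit with `n + 2` rare-reward arms and their rarity indices.  Arm `0` of the formalization
is the arm `1` of the usual numbering, and so on. -/
structure RareBandit (n : ℕ) where
  arm : Fin (n + 2) → RareArm
  /-- The rarity indices. -/
  α : Fin (n + 2) → ℝ
  α_pos : ∀ i, 0 < α i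

namespace RareBandit

variable {n : ℕ}

/-- The mean of arm `i`. -/
noncomputable def mean (b : RareBandit n) (i : Fin (n + 2)) : ℝ := (b.arm i).mean

/-- The largest rarity index. -/
noncomputable def αmax (b : RareBandit n) : ℝ := Finset.univ.sup' Finset.univ_nonempty b.α

/-- The arms other than the best arm `0` whose rarity index is maximal. -/
noncomputable def rarest (b : RareBandit n) : Finset (Fin (n + 2)) :=
  {i | i ≠ 0 ∧ b.α i = b.αmax}

/-! ### The approximate lower-bound problem -/

/-- The inner problem: the infimum of
`w_0 γ^{α_0} KL(p_0, q₀) + w_i γ^{α_i} KL(p_i, q)` (Poisson approximations) over all alternatives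
under which the mean of arm `i` is at least the mean of arm `0`. -/
noncomputable def innerValue (b : RareBandit n) (γ : ℝ) (w : Fin (n + 2) → ℝ)
    (i : Fin (n + 2)) : ℝ :=
  sInf {v : ℝ | ∃ q₀ q : ℝ → ℝ, (b.arm 0).IsAlternative q₀ ∧ (b.arm i).IsAlternative q ∧
    (b.arm 0).altMean q₀ ≤ (b.arm i).altMean q ∧
    v = w 0 * γ ^ b.α 0 * (b.arm 0).poissonKL q₀ + w i * γ ^ b.α i * (b.arm i).poissonKL q}

/-- The objective of the max-min problem: the minimum of the inner values over `i ≠ 0`. -/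
noncomputable def objective (b : RareBandit n) (γ : ℝ) (w : Fin (n + 2) → ℝ) : ℝ :=
  ⨅ i : {i : Fin (n + 2) // i ≠ 0}, b.innerValue γ w i

/-- `w` is a vector of optimal weights: it maximizes the objective over the simplex. -/
def IsOptimal (b : RareBandit n) (γ : ℝ) (w : Fin (n + 2) → ℝ) : Prop :=
  w ∈ stdSimplex ℝ (Fin (n + 2)) ∧ IsMaxOn (b.objective γ) (stdSimplex ℝ (Fin (n + 2))) w

/-- `w` gives optimal weights for all small `γ > 0`. -/
def IsOptimalFamily (b : RareBandit n) (w : ℝ → Fin (n + 2) → ℝ) : Prop :=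
  ∀ᶠ γ in 𝓝[>] (0 : ℝ), b.IsOptimal γ (w γ)

/-! ### The implicit functions -/

/-- `y = g_i(r)`: lowering the mean of arm `0` with parameter `y` and raising the mean of arm `i`
with parameter `r` leads to the same mean `∑ a p_0(a) / (1 + y a)`. -/
def IsG (b : RareBandit n) (i : Fin (n + 2)) (r y : ℝ) : Prop :=
  0 ≤ y ∧ (b.arm i).IsRaise r ((b.arm 0).meanLow y)

/-- For `y = g_i(r)`, the value
`f_i(r) = ∑ p_0(a) log (1 + y a) + (y / r) ∑ p_i(a) log (1 - r a)`, with its limiting value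
`∑ p_0(a) log (1 + y a) - y μ_i` at `r = 0`. -/
noncomputable def f (b : RareBandit n) (i : Fin (n + 2)) (r y : ℝ) : ℝ :=
  if r = 0 then (b.arm 0).logUp y - y * b.mean i
  else (b.arm 0).logUp y + y / r * (b.arm i).logDown r

/-- The divergence `∑ p_i(a) log (1 - r a) + r x` of the arm `i` from its version with mean raised
to `x` by means of the parameter `r`. -/
noncomputable def divHigh (b : RareBandit n) (i : Fin (n + 2)) (r x : ℝ) : ℝ :=
  (b.arm i).logDown r + r * x

/-- For `y = g_i(r)`, the value `h_i(r)`: the quotient of the two divergences. -/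
noncomputable def h (b : RareBandit n) (i : Fin (n + 2)) (r y : ℝ) : ℝ :=
  ((b.arm 0).logUp y - y * (b.arm 0).meanLow y) / b.divHigh i r ((b.arm 0).meanLow y)

/-- A profile `q` of parameters `q i = (r_i, y_i)`, for `i ≠ 0`, with `y_i = g_i(r_i)` and
`f_i(r_i) = f_j(r_j)` for all `i` and `j`; that is, `r_i = ξ_i(r_1)`.  The value `q 0` plays no role
and is set to zero. -/
structure IsProfile (b : RareBandit n) (q : Fin (n + 2) → ℝ × ℝ) : Prop where
  zero : q 0 = 0
  isG : ∀ i, i ≠ 0 → b.IsG i (q i).1 (q i).2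
  level : ∀ i, i ≠ 0 → b.f i (q i).1 (q i).2 = b.f 1 (q 1).1 (q 1).2

/-- The sum of `h_i` over the rarest arms `i ≠ 0`. -/
noncomputable def ratioSum (b : RareBandit n) (q : Fin (n + 2) → ℝ × ℝ) : ℝ :=
  ∑ i ∈ b.rarest, b.h i (q i).1 (q i).2

/-- The profile at which the parameter of the second best arm vanishes:
`q i = (ξ_i(0), g_i(ξ_i(0)))`. -/
def IsXiZero (b : RareBandit n) (q : Fin (n + 2) → ℝ × ℝ) : Prop :=
  b.IsProfile q ∧ (q 1).1 = 0

/-- A profile at which the sum of the `h_i` over the rarest arms `i ≠ 0` equals one. -/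
def IsBalanced (b : RareBandit n) (q : Fin (n + 2) → ℝ × ℝ) : Prop :=
  b.IsProfile q ∧ b.ratioSum q = 1

/-- The quantity `ζ = ∑ h_i(ξ_i(0))` over the rarest arms `i ≠ 0`, computed from the profile
`ξ` with `IsXiZero`. -/
noncomputable def ζ (b : RareBandit n) (ξ : Fin (n + 2) → ℝ × ℝ) : ℝ := b.ratioSum ξ

/-! ### The limiting constants -/

/-- The common part of the limits for `i ≠ 0`:
the ratio `y_i / r_i` of the parameters divided by `1 + ∑ y_k / r_k` (over the rarest arms
`k ≠ 0`), and `1 / (1 + ∑ y_k / r_k)` for `i = 0`. -/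
noncomputable def limProfile (b : RareBandit n) (q : Fin (n + 2) → ℝ × ℝ) (i : Fin (n + 2)) : ℝ :=
  (if i = 0 then 1 else (q i).2 / (q i).1) / (1 + ∑ k ∈ b.rarest, (q k).2 / (q k).1)

/-- The limit for the second best arm when its parameter tends to zero:
`y_1 √((1 - ζ) σ_1² / (2 f_1(0))) / (1 + ∑ y_k / r_k)`, where `σ_1²` is the second moment
of that arm. -/
noncomputable def limSecond (b : RareBandit n) (ξ : Fin (n + 2) → ℝ × ℝ) : ℝ :=
  (ξ 1).2 * √((1 - b.ζ ξ) * (b.arm 1).secondMoment / (2 * b.f 1 0 (ξ 1).2)) /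
    (1 + ∑ k ∈ b.rarest, (ξ k).2 / (ξ k).1)

/-- The parameters `A i` that raise the mean of each arm `i ≠ 0` to the mean of the best arm;
the value `A 0` plays no role and is set to zero. -/
def IsTopTilt (b : RareBandit n) (A : Fin (n + 2) → ℝ) : Prop :=
  A 0 = 0 ∧ ∀ i, i ≠ 0 → (b.arm i).IsRaise (A i) (b.mean 0)

/-- The limits for `i ≠ 0` when the best arm is not the rarest: `(1 / D_i) / ∑ 1 / D_k`,
where `D_i` is the divergence of arm `i` from its version with mean raised to the best mean and
the sum is over the rarest arms. -/
noncomputable def limOther (b : RareBandit n) (A : Fin (n + 2) → ℝ) (i : Fin (n + 2)) : ℝ :=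
  (1 / b.divHigh i (A i) (b.mean 0)) / ∑ k ∈ b.rarest, 1 / b.divHigh k (A k) (b.mean 0)

/-- The limit for the best arm when it is not the rarest: with the limits `L_k` and the
divergences `D_k` above, `√(σ_0² / 2 * ∑ A_k² L_k² / D_k)`, the sum over the rarest arms. -/
noncomputable def limBest (b : RareBandit n) (A : Fin (n + 2) → ℝ) : ℝ :=
  √((b.arm 0).secondMoment / 2 *
    ∑ k ∈ b.rarest, A k ^ 2 * b.limOther A k ^ 2 / b.divHigh k (A k) (b.mean 0))

/-! ### Orders as `γ → 0` -/

/-- `u(γ) / γ^e` tends to `L` as `γ → 0`, `γ > 0`. -/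
def HasScaledLimit (u : ℝ → ℝ) (e L : ℝ) : Prop :=
  Tendsto (fun γ => u γ / γ ^ e) (𝓝[>] (0 : ℝ)) (𝓝 L)

/-- `u(γ) = Θ(γ^e)` as `γ → 0`, `γ > 0`, and `u(γ) / γ^e` tends to `L`. -/
def HasOrder (u : ℝ → ℝ) (e L : ℝ) : Prop :=
  u =Θ[𝓝[>] (0 : ℝ)] (fun γ => γ ^ e) ∧ HasScaledLimit u e L

end RareBandit

/-!
The inner problem compares the best arm, lowered to a common mean, with arm `i`, raised to that
mean. Its solutions are tilted weights: the best arm is divided by `1 + y a` and arm `i` by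
`1 - r a`, with additional mass at `B` once `r` has reached `1 / B`. The tangent inequality for the
logarithm shows that every tilting parameter bounds the divergence from below by an affine function
of the mean (`RareArm.logUp_sub_le_poissonKL`), with equality for tilted weights. Hence, whenever
`u y = v r`, the inner problem with rescaled weights `u` and `v` has the value `u f_i`, so that
`f_i` is a strictly increasing function of `y` with the quotient `y / r` as the relative weight of
arm `i`. A profile is then determined by its common level `e`, which ranges over `[0, E]`.

Let `e < E` be the level with `∑ γ ^ (α 0 - α i) h_i(e) = 1`; it exists and is unique since the
`h_i` increase strictly from zero, that of the second best arm to infinity. Averaging the bounds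
given by the pairs of alternatives at this level with multipliers proportional to
`γ ^ (α 0 - α i) / D_i`, where `D_i` is the divergence of the raised arm `i`, gives a bound for the
objective that is the same for all weights in the simplex, and the weights with relative weights
`γ ^ (α 0 - α i) y_i / r_i` attain it. Conversely, weights attaining it make the pair of
alternatives at level `e` a minimizer of every inner problem, and the first-order condition
(`RareArm.mul_eq_mul_raise_of_isMinOn`) determines them. So the optimal weights are explicit in
terms of `e` (`RareBandit.isOptimal_iff`).

What remains is the behavior of the level as `γ → 0`. If the best arm is not the rarest, the level
tends to zero, where `y / r` is linear and `h_i` is quadratic in the level. If the best arm is among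
the rarest, only the rarest arms contribute to the limit of the condition on the level. Either that
limit condition has a solution below `E`, to which the level converges, or the level tends to `E`;
in the latter case `h` of the second best arm is asymptotically `2 E / (σ² r²)`, and the factor
`γ ^ (α 0 - α 1)` makes it contribute the missing part `1 - ζ` of the condition.
-/

/-! ### Elementary properties of an arm -/

namespace RareArm

variable (A : RareArm)

lemma B_pos : 0 < A.B := by
  obtain ⟨a, ha⟩ := A.supp_nonempty
  exact (A.supp_pos a ha).trans_le (A.supp_le a ha)

lemma mean_pos : 0 < A.mean :=
  Finset.sum_pos (fun a ha => mul_pos (A.supp_pos a ha) (A.p_pos a ha)) A.supp_nonempty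

lemma secondMoment_pos : 0 < A.secondMoment :=
  Finset.sum_pos (fun a ha => mul_pos (pow_pos (A.supp_pos a ha) 2) (A.p_pos a ha))
    A.supp_nonempty

lemma logDown_eq (r : ℝ) : A.logDown r = A.logUp (-r) := by
  simp [logDown, logUp, sub_eq_add_neg]

lemma meanHigh_eq (r : ℝ) : A.meanHigh r = A.meanLow (-r) := by
  simp [meanHigh, meanLow, sub_eq_add_neg]

@[simp] lemma meanLow_zero : A.meanLow 0 = A.mean := by simp [meanLow, mean]

@[simp] lemma logUp_zero : A.logUp 0 = 0 := by simp [logUp]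

@[simp] lemma logDown_zero : A.logDown 0 = 0 := by simp [logDown]

@[simp] lemma meanHigh_zero : A.meanHigh 0 = A.mean := by simp [meanHigh, mean]

/-- The tilting parameters `s` for which all the weights `p a / (1 + s a)` are positive.  Lowering
the mean by means of `y` is the tilt `s = y`, raising it by means of `r` is the tilt `s = -r`. -/
def Admissible (s : ℝ) : Prop := ∀ a ∈ A.supp, 0 < 1 + s * a

variable {A}

lemma admissible_of_nonneg {s : ℝ} (hs : 0 ≤ s) : A.Admissible s := fun a ha => by
  have := mul_nonneg hs (A.supp_pos a ha).le
  linarith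

lemma admissible_neg_of_mul_lt {r : ℝ} (hr : 0 ≤ r) (h : r * A.B < 1) : A.Admissible (-r) :=
  fun a ha => by
    have := mul_le_mul_of_nonneg_left (A.supp_le a ha) hr
    linarith

lemma meanLow_lt {s t : ℝ} (hs : A.Admissible s) (hst : s < t) : A.meanLow t < A.meanLow s := by
  refine Finset.sum_lt_sum_of_nonempty A.supp_nonempty fun a ha => ?_
  have h0 := A.supp_pos a ha
  have := mul_lt_mul_of_pos_right hst h0
  exact div_lt_div_of_pos_left (mul_pos h0 (A.p_pos a ha)) (hs a ha) (by linarith)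

lemma continuousAt_meanLow {s : ℝ} (hs : A.Admissible s) : ContinuousAt A.meanLow s := by
  unfold meanLow
  refine tendsto_finsetSum _ fun a ha => ?_
  exact ContinuousAt.div (by fun_prop) (by fun_prop) (hs a ha).ne'

lemma continuousAt_logUp {s : ℝ} (hs : A.Admissible s) : ContinuousAt A.logUp s := by
  unfold logUp
  refine tendsto_finsetSum _ fun a ha => ?_
  exact ContinuousAt.mul (by fun_prop) (ContinuousAt.log (by fun_prop) (hs a ha).ne')

lemma continuousOn_meanLow : ContinuousOn A.meanLow (Set.Ici 0) := fun _ hs =>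
  (continuousAt_meanLow (admissible_of_nonneg hs)).continuousWithinAt

/-! ### Weak duality for the divergence -/

lemma logUp_eq_sum_extSupp (s : ℝ) :
    A.logUp s = ∑ a ∈ A.extSupp, A.p a * Real.log (1 + s * a) := by
  refine Finset.sum_subset (Finset.subset_insert _ _) fun a _ ha => ?_
  rw [A.p_off a ha, zero_mul]

/-- Weak duality: every tilting parameter `s` bounds the divergence of an alternative from below
by a function of the mean of the alternative. -/
lemma logUp_sub_le_poissonKL {q : ℝ → ℝ} (hq : A.IsAlternative q) {s : ℝ}
    (hs : A.Admissible s) (hB : 0 ≤ 1 + s * A.B) :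
    A.logUp s - s * A.altMean q ≤ A.poissonKL q := by
  rw [logUp_eq_sum_extSupp, altMean, Finset.mul_sum, ← Finset.sum_sub_distrib]
  refine Finset.sum_le_sum fun a ha => ?_
  by_cases hmem : a ∈ A.supp
  · have hp := A.p_pos a hmem
    have hq' := hq.2 a hmem
    have h1 := hs a hmem
    have h2 := Real.one_sub_inv_le_log_of_pos (x := A.p a / (q a * (1 + s * a))) (by positivity)
    have h3 : Real.log (A.p a / (q a * (1 + s * a)))
        = Real.log (A.p a / q a) - Real.log (1 + s * a) := by
      rw [← div_div, Real.log_div (by positivity) h1.ne']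
    rw [h3] at h2
    have h4 := mul_le_mul_of_nonneg_left h2 hp.le
    have h5 : A.p a * (1 - (A.p a / (q a * (1 + s * a)))⁻¹) = A.p a - q a * (1 + s * a) := by
      field_simp
    rw [h5] at h4
    linarith
  · have haB : a = A.B := by
      rcases Finset.mem_insert.1 ha with h | h
      · exact h
      · exact absurd h hmem
    rw [A.p_off a hmem, haB]
    have := mul_nonneg (hq.1 a ha) hB
    rw [haB] at this
    simp only [zero_mul, zero_sub, sub_zero, zero_add]
    linarith

lemma poissonKL_nonneg {q : ℝ → ℝ} (hq : A.IsAlternative q) : 0 ≤ A.poissonKL q := by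
  simpa using logUp_sub_le_poissonKL hq (s := 0) (admissible_of_nonneg le_rfl) (by simp)

/-- The tilted weights `p a / (1 + s a)`, with additional mass `m` at `B`. -/
noncomputable def tilted (A : RareArm) (s m : ℝ) (a : ℝ) : ℝ :=
  A.p a / (1 + s * a) + if a = A.B then m else 0

lemma isAlternative_tilted {s m : ℝ} (hs : A.Admissible s) (hm : 0 ≤ m) :
    A.IsAlternative (A.tilted s m) := by
  have h : ∀ a ∈ A.supp, 0 < A.tilted s m a := fun a ha => by
    have h1 := div_pos (A.p_pos a ha) (hs a ha)
    unfold tilted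
    split_ifs <;> linarith
  refine ⟨fun a ha => ?_, h⟩
  by_cases hmem : a ∈ A.supp
  · exact (h a hmem).le
  · unfold tilted
    rw [A.p_off a hmem]
    split_ifs <;> simp [hm]

lemma altMean_tilted (s m : ℝ) : A.altMean (A.tilted s m) = A.meanLow s + A.B * m := by
  unfold altMean tilted
  simp_rw [mul_add]
  rw [Finset.sum_add_distrib]
  congr 1
  · symm
    unfold meanLow
    simp_rw [← mul_div_assoc]
    refine Finset.sum_subset (Finset.subset_insert _ _) fun a _ ha => ?_
    rw [A.p_off a ha, mul_zero, zero_div]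
  · simp [extSupp]

/-- The bound of weak duality is attained by tilted weights, whose additional mass at `B` is zero
unless the tilting parameter is the extreme one. -/
lemma poissonKL_tilted {s m : ℝ} (hs : A.Admissible s) (hm : m * (1 + s * A.B) = 0) :
    A.poissonKL (A.tilted s m) = A.logUp s - s * (A.meanLow s + A.B * m) := by
  rw [← altMean_tilted, logUp_eq_sum_extSupp, altMean, Finset.mul_sum, ← Finset.sum_sub_distrib]
  refine Finset.sum_congr rfl fun a ha => ?_
  have hm' : (if a = A.B then m else 0) * (1 + s * a) = 0 := by
    split_ifs with h
    · rw [h, hm]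
    · simp
  unfold tilted
  set k := if a = A.B then m else 0
  by_cases hmem : a ∈ A.supp
  · have h1 := hs a hmem
    have hp := A.p_pos a hmem
    have hk : k = 0 := by simpa [h1.ne'] using hm'
    rw [hk, add_zero, div_div_cancel₀ hp.ne']
    field_simp
    ring
  · rw [A.p_off a hmem]
    simp only [zero_mul, zero_div, zero_add, sub_zero, zero_sub]
    linear_combination hm'

/-! ### The divergence of a tilted arm -/

/-- The divergence of an arm from its version tilted by `s`. -/
noncomputable def tiltDiv (A : RareArm) (s : ℝ) : ℝ := A.logUp s - s * A.meanLow s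

lemma tiltDiv_eq_sum {s : ℝ} :
    A.tiltDiv s = ∑ a ∈ A.supp, A.p a * (Real.log (1 + s * a) - s * a / (1 + s * a)) := by
  unfold tiltDiv logUp meanLow
  rw [Finset.mul_sum, ← Finset.sum_sub_distrib]
  exact Finset.sum_congr rfl fun a _ => by ring

@[simp] lemma tiltDiv_zero : A.tiltDiv 0 = 0 := by simp [tiltDiv]

lemma tiltDiv_pos {s : ℝ} (hs : A.Admissible s) (h0 : s ≠ 0) : 0 < A.tiltDiv s := by
  rw [tiltDiv_eq_sum]
  refine Finset.sum_pos (fun a ha => mul_pos (A.p_pos a ha) ?_) A.supp_nonempty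
  have h1 := hs a ha
  have hsa : s * a ≠ 0 := mul_ne_zero h0 (A.supp_pos a ha).ne'
  have h2 := Real.log_lt_sub_one_of_pos (x := (1 + s * a)⁻¹) (by positivity)
    (by rw [Ne, inv_eq_one]; simpa using hsa)
  rw [Real.log_inv] at h2
  have h3 : (1 + s * a)⁻¹ - 1 = -(s * a / (1 + s * a)) := by field_simp; ring
  linarith

lemma continuousAt_tiltDiv {s : ℝ} (hs : A.Admissible s) : ContinuousAt A.tiltDiv s :=
  (continuousAt_logUp hs).sub (continuousAt_id.mul (continuousAt_meanLow hs))

lemma logUp_sub_le_tiltDiv {s t : ℝ} (hs : 0 ≤ s) (ht : 0 ≤ t) :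
    A.logUp s - s * A.meanLow t ≤ A.tiltDiv t := by
  have hB := A.B_pos
  have h := logUp_sub_le_poissonKL (isAlternative_tilted (admissible_of_nonneg ht) le_rfl)
    (admissible_of_nonneg (A := A) hs) (by positivity)
  rwa [poissonKL_tilted (admissible_of_nonneg ht) (by simp), altMean_tilted, mul_zero,
    add_zero] at h

lemma strictMonoOn_tiltDiv : StrictMonoOn A.tiltDiv (Set.Ici 0) := by
  intro s hs t ht hst
  rcases eq_or_lt_of_le (Set.mem_Ici.1 hs) with rfl | hs'
  · rw [tiltDiv_zero]
    exact tiltDiv_pos (admissible_of_nonneg ht) hst.ne'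
  · have h1 := logUp_sub_le_tiltDiv (A := A) hs ht
    have h2 := mul_lt_mul_of_pos_left (meanLow_lt (admissible_of_nonneg (A := A) hs) hst) hs'
    unfold tiltDiv at *
    linarith

/-- The second-order behavior at zero of the divergence of a single tilted point. -/
lemma tendsto_log_sub_div_sq :
    Tendsto (fun z : ℝ => (Real.log (1 + z) - z / (1 + z)) / z ^ 2) (𝓝[≠] 0) (𝓝 (1 / 2)) := by
  have hnear : ∀ᶠ z : ℝ in 𝓝[≠] 0, 0 < 1 + z :=
    (eventually_nhdsWithin_of_eventually_nhds
      ((eventually_gt_nhds (show (-1 : ℝ) < 0 by norm_num)).mono fun z hz => by linarith))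
  refine HasDerivAt.lhopital_zero_nhdsNE (f' := fun z => z / (1 + z) ^ 2) (g' := fun z => 2 * z)
    ?_ ?_ ?_ ?_ ?_ ?_
  · filter_upwards [hnear] with z hz
    have h1 : HasDerivAt (fun z : ℝ => 1 + z) 1 z := (hasDerivAt_id z).const_add 1
    refine ((h1.log hz.ne').sub ((hasDerivAt_id z).div h1 hz.ne')).congr_deriv ?_
    simp only [id]
    field_simp
    ring
  · filter_upwards with z
    simpa using hasDerivAt_pow 2 z
  · filter_upwards [self_mem_nhdsWithin] with z hz
    simpa using hz
  · have : ContinuousAt (fun z : ℝ => Real.log (1 + z) - z / (1 + z)) 0 :=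
      (ContinuousAt.log (by fun_prop) (by norm_num)).sub
        (ContinuousAt.div (by fun_prop) (by fun_prop) (by norm_num))
    simpa using this.tendsto.mono_left nhdsWithin_le_nhds
  · have : ContinuousAt (fun z : ℝ => z ^ 2) 0 := by fun_prop
    simpa using this.tendsto.mono_left nhdsWithin_le_nhds
  · have : ContinuousAt (fun z : ℝ => 1 / (2 * (1 + z) ^ 2)) 0 :=
      ContinuousAt.div (by fun_prop) (by fun_prop) (by norm_num)
    have h := this.tendsto.mono_left (nhdsWithin_le_nhds (s := {0}ᶜ))
    simp only [add_zero, one_pow, mul_one] at h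
    refine h.congr' ?_
    filter_upwards [hnear, self_mem_nhdsWithin] with z hz hz0
    have : z ≠ 0 := hz0
    field_simp

/-- The divergence of a slightly tilted arm is quadratic in the tilting parameter. -/
lemma tendsto_tiltDiv_div_sq :
    Tendsto (fun s => A.tiltDiv s / s ^ 2) (𝓝[≠] 0) (𝓝 (A.secondMoment / 2)) := by
  have key : Tendsto (fun s : ℝ => ∑ a ∈ A.supp, a ^ 2 * A.p a *
      ((Real.log (1 + s * a) - s * a / (1 + s * a)) / (s * a) ^ 2)) (𝓝[≠] 0)
      (𝓝 (∑ a ∈ A.supp, a ^ 2 * A.p a * (1 / 2))) := by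
    refine tendsto_finsetSum _ fun a ha => Tendsto.const_mul _ ?_
    refine tendsto_log_sub_div_sq.comp (tendsto_nhdsWithin_iff.2 ⟨?_, ?_⟩)
    · have : ContinuousAt (fun s : ℝ => s * a) 0 := by fun_prop
      simpa using this.tendsto.mono_left nhdsWithin_le_nhds
    · filter_upwards [self_mem_nhdsWithin] with s hs
      exact mul_ne_zero hs (A.supp_pos a ha).ne'
  rw [← Finset.sum_mul] at key
  convert key.congr' ?_ using 2
  · unfold secondMoment
    ring
  · filter_upwards [self_mem_nhdsWithin] with s hs
    have hs' : s ≠ 0 := hs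
    rw [tiltDiv_eq_sum, Finset.sum_div]
    refine Finset.sum_congr rfl fun a ha => ?_
    have := (A.supp_pos a ha).ne'
    generalize Real.log (1 + s * a) - s * a / (1 + s * a) = k
    field_simp

/-! ### Raising the mean of an arm -/

namespace IsRaise

variable {r r' x x' : ℝ}

lemma admissible (h : A.IsRaise r x) : A.Admissible (-r) := fun a ha => by
  linarith [h.2.1 a ha]

lemma mul_B_le (h : A.IsRaise r x) : r * A.B ≤ 1 := by
  rcases h.2.2 with h | h
  · exact h.1
  · exact h.1.le

lemma meanHigh_le (h : A.IsRaise r x) : A.meanHigh r ≤ x := by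
  rcases h.2.2 with h | h
  · exact h.2.le
  · exact h.2

lemma meanHigh_eq_of_lt (h : A.IsRaise r x) (hr : r * A.B < 1) : A.meanHigh r = x := by
  rcases h.2.2 with h | h
  · exact h.2
  · exact absurd h.1 hr.ne

/-- The raising parameter is monotone in the mean; in particular it is unique. -/
lemma le_of_le (h : A.IsRaise r x) (h' : A.IsRaise r' x') (hx : x ≤ x') : r ≤ r' := by
  by_contra! hlt
  have h1 : r' * A.B < 1 := (mul_lt_mul_of_pos_right hlt A.B_pos).trans_le h.mul_B_le
  have h2 := meanLow_lt h.admissible (neg_lt_neg hlt)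
  rw [← A.meanHigh_eq, ← A.meanHigh_eq, h'.meanHigh_eq_of_lt h1] at h2
  linarith [h.meanHigh_le]

lemma unique (h : A.IsRaise r x) (h' : A.IsRaise r' x) : r = r' :=
  le_antisymm (h.le_of_le h' le_rfl) (h'.le_of_le h le_rfl)

lemma mean_le (h : A.IsRaise r x) : A.mean ≤ x := by
  refine le_trans ?_ h.meanHigh_le
  rcases eq_or_lt_of_le h.1 with h0 | h0
  · rw [← h0, A.meanHigh_zero]
  · rw [A.meanHigh_eq, ← A.meanLow_zero]
    exact (meanLow_lt h.admissible (by linarith)).le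

end IsRaise

lemma isRaise_zero : A.IsRaise 0 A.mean :=
  ⟨le_rfl, by simp, Or.inl ⟨by simp, by simp⟩⟩

lemma exists_isRaise {x : ℝ} (hx : A.mean ≤ x) : ∃ r, A.IsRaise r x := by
  have hB := A.B_pos
  -- The intermediate value theorem up to an admissible parameter that raises the mean enough.
  have ivt : ∀ R : ℝ, 0 ≤ R → R * A.B ≤ 1 → A.Admissible (-R) → x ≤ A.meanHigh R →
      ∃ r, A.IsRaise r x := by
    intro R hR hRB hadm hxR
    have hadm' : ∀ r ∈ Set.Icc 0 R, A.Admissible (-r) := fun r hr a ha => by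
      have := mul_le_mul_of_nonneg_right hr.2 (A.supp_pos a ha).le
      linarith [hadm a ha]
    have hcont : ContinuousOn (fun r => A.meanLow (-r)) (Set.Icc 0 R) := fun r hr =>
      (ContinuousAt.comp (f := fun r : ℝ => -r) (continuousAt_meanLow (hadm' r hr))
        continuous_neg.continuousAt).continuousWithinAt
    obtain ⟨r, hr, hrx⟩ := intermediate_value_Icc hR hcont
      (show x ∈ Set.Icc _ _ by simpa [← A.meanHigh_eq] using ⟨hx, hxR⟩)
    refine ⟨r, hr.1, fun a ha => by linarith [hadm' r hr a ha], Or.inl ⟨?_, ?_⟩⟩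
    · exact (mul_le_mul_of_nonneg_right hr.2 hB.le).trans hRB
    · exact (A.meanHigh_eq r).trans hrx
  by_cases hmem : A.B ∈ A.supp
  · -- The term of the point `B` alone reaches `x` before `r = 1 / B`.
    have hx0 : 0 < x := A.mean_pos.trans_le hx
    have hp := A.p_pos _ hmem
    set d := min 1 (A.B * A.p A.B / x) with hd
    have hd0 : 0 < d := lt_min one_pos (by positivity)
    have hd1 : d ≤ 1 := min_le_left _ _
    have hmul : (1 - d) / A.B * A.B = 1 - d := by field_simp
    have hadm : A.Admissible (-((1 - d) / A.B)) :=
      admissible_neg_of_mul_lt (div_nonneg (by linarith) hB.le) (by rw [hmul]; linarith)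
    refine ivt ((1 - d) / A.B) (div_nonneg (by linarith) hB.le) (by rw [hmul]; linarith) hadm ?_
    have h1 : A.B * A.p A.B / (1 - (1 - d) / A.B * A.B) ≤ A.meanHigh ((1 - d) / A.B) := by
      unfold meanHigh
      refine Finset.single_le_sum
        (f := fun a => a * A.p a / (1 - (1 - d) / A.B * a)) (fun a ha => ?_) hmem
      have := hadm a ha
      exact div_nonneg (mul_pos (A.supp_pos a ha) (A.p_pos a ha)).le (by linarith)
    refine le_trans ?_ h1
    rw [hmul, sub_sub_cancel, le_div_iff₀ hd0]
    calc x * d ≤ x * (A.B * A.p A.B / x) := by gcongr; exact min_le_right _ _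
      _ = A.B * A.p A.B := by field_simp
  · have hadm : A.Admissible (-(1 / A.B)) := fun a ha => by
      have : a / A.B < 1 := (div_lt_one hB).2
        (lt_of_le_of_ne (A.supp_le a ha) fun h => hmem (h ▸ ha))
      have h2 : -(1 / A.B) * a = -(a / A.B) := by ring
      linarith
    have hmul : 1 / A.B * A.B = 1 := by field_simp
    rcases le_total x (A.meanHigh (1 / A.B)) with h | h
    · exact ivt _ (by positivity) hmul.le hadm h
    · exact ⟨1 / A.B, by positivity, fun a ha => by linarith [hadm a ha], Or.inr ⟨hmul, h⟩⟩

/-- The parameter `C(x)` that raises the mean of the arm to `x` (for `x` at least the mean). -/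
noncomputable def tilt (A : RareArm) (x : ℝ) : ℝ := Classical.epsilon fun r => A.IsRaise r x

lemma isRaise_tilt {x : ℝ} (hx : A.mean ≤ x) : A.IsRaise (A.tilt x) x :=
  Classical.epsilon_spec (exists_isRaise hx)

lemma IsRaise.eq_tilt {r x : ℝ} (h : A.IsRaise r x) : r = A.tilt x :=
  h.unique (isRaise_tilt h.mean_le)

@[simp] lemma tilt_mean : A.tilt A.mean = 0 := isRaise_zero.eq_tilt.symm

lemma tilt_pos {x : ℝ} (hx : A.mean < x) : 0 < A.tilt x := by
  have h := isRaise_tilt hx.le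
  refine lt_of_le_of_ne h.1 fun h0 => ?_
  have := h.meanHigh_eq_of_lt (by rw [← h0]; simp)
  rw [← h0, A.meanHigh_zero] at this
  exact hx.ne this

lemma continuousOn_tilt : ContinuousOn A.tilt (Set.Ici A.mean) := by
  intro x hx
  have hr := isRaise_tilt (Set.mem_Ici.1 hx)
  have hB := A.B_pos
  refine tendsto_order.2 ⟨fun r' hr' => ?_, fun r' hr' => ?_⟩
  · rcases lt_or_ge r' 0 with h0 | h0
    · filter_upwards [self_mem_nhdsWithin] with z hz
      exact h0.trans_le (isRaise_tilt hz).1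
    · -- A parameter strictly between `r'` and `tilt x` still has its raised mean below `x`.
      obtain ⟨s, hs1, hs2⟩ := exists_between hr'
      have hsx : A.meanHigh s < x := by
        have := meanLow_lt hr.admissible (neg_lt_neg hs2)
        rw [← A.meanHigh_eq, ← A.meanHigh_eq] at this
        exact this.trans_le hr.meanHigh_le
      have hsB : s * A.B < 1 := (mul_lt_mul_of_pos_right hs2 hB).trans_le hr.mul_B_le
      have hs0 : 0 ≤ s := h0.trans hs1.le
      have hs : A.IsRaise s (A.meanHigh s) :=
        ⟨hs0, fun a ha => by linarith [admissible_neg_of_mul_lt hs0 hsB a ha],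
          Or.inl ⟨hsB.le, rfl⟩⟩
      filter_upwards [self_mem_nhdsWithin, eventually_nhdsWithin_of_eventually_nhds
        (eventually_gt_nhds hsx)] with z hz hz'
      exact hs1.trans_le (hs.le_of_le (isRaise_tilt hz) hz'.le)
  · rcases lt_or_ge (A.tilt x * A.B) 1 with h1 | h1
    · obtain ⟨s, hs1, hs2⟩ := exists_between (lt_min hr' ((lt_div_iff₀ hB).2 h1))
      have hs0 : 0 ≤ s := hr.1.trans hs1.le
      have hsB : s * A.B < 1 := (lt_div_iff₀ hB).1 (hs2.trans_le (min_le_right _ _))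
      have hadm := admissible_neg_of_mul_lt hs0 hsB
      have hsx : x < A.meanHigh s := by
        have := meanLow_lt hadm (neg_lt_neg hs1)
        rwa [← A.meanHigh_eq, ← A.meanHigh_eq, hr.meanHigh_eq_of_lt h1] at this
      have hs : A.IsRaise s (A.meanHigh s) :=
        ⟨hs0, fun a ha => by linarith [hadm a ha], Or.inl ⟨hsB.le, rfl⟩⟩
      filter_upwards [self_mem_nhdsWithin, eventually_nhdsWithin_of_eventually_nhds
        (eventually_lt_nhds hsx)] with z hz hz'
      exact ((isRaise_tilt hz).le_of_le hs hz'.le).trans_lt (hs2.trans_le (min_le_left _ _))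
    · filter_upwards [self_mem_nhdsWithin] with z hz
      have := (isRaise_tilt hz).mul_B_le
      exact (le_of_mul_le_mul_right (this.trans h1) hB).trans_lt hr'

/-- The divergence of an arm from its version with the mean raised to `x` by means of `r`. -/
noncomputable def raiseDiv (A : RareArm) (r x : ℝ) : ℝ := A.logDown r + r * x

/-- The alternative with mean `x` and the smallest divergence: tilted weights, with the missing part
of the mean at `B`. -/
lemma IsRaise.exists_alternative {r x : ℝ} (h : A.IsRaise r x) :
    ∃ q, A.IsAlternative q ∧ A.altMean q = x ∧ A.poissonKL q = A.raiseDiv r x := by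
  have hB := A.B_pos
  have hx : A.meanLow (-r) + A.B * ((x - A.meanHigh r) / A.B) = x := by
    rw [← A.meanHigh_eq]
    field_simp
    ring
  refine ⟨A.tilted (-r) ((x - A.meanHigh r) / A.B), isAlternative_tilted h.admissible
    (div_nonneg (sub_nonneg.2 h.meanHigh_le) hB.le), ?_, ?_⟩
  · rw [altMean_tilted, hx]
  · rw [poissonKL_tilted h.admissible, hx, ← A.logDown_eq, raiseDiv]
    · ring
    · rcases lt_or_eq_of_le h.mul_B_le with h1 | h1
      · rw [h.meanHigh_eq_of_lt h1]
        simp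
      · rw [neg_mul, h1]
        simp

/-- Weak duality for raised means. -/
lemma IsRaise.logDown_add_le {r x : ℝ} (h : A.IsRaise r x) {q : ℝ → ℝ} (hq : A.IsAlternative q) :
    A.logDown r + r * A.altMean q ≤ A.poissonKL q := by
  have := logUp_sub_le_poissonKL hq h.admissible (by linarith [h.mul_B_le])
  rwa [← A.logDown_eq, neg_mul, sub_neg_eq_add] at this

lemma IsRaise.logDown_add_le_raiseDiv {r r' x x' : ℝ} (h : A.IsRaise r x)
    (h' : A.IsRaise r' x') : A.logDown r + r * x' ≤ A.raiseDiv r' x' := by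
  obtain ⟨q, hq, hm, hd⟩ := h'.exists_alternative
  rw [← hd, ← hm]
  exact h.logDown_add_le hq

lemma raiseDiv_eq (r x : ℝ) :
    A.raiseDiv r x = A.tiltDiv (-r) + r * (x - A.meanHigh r) := by
  rw [raiseDiv, tiltDiv, A.logDown_eq, A.meanHigh_eq]
  ring

lemma IsRaise.raiseDiv_pos {r x : ℝ} (h : A.IsRaise r x) (hr : 0 < r) : 0 < A.raiseDiv r x := by
  rw [raiseDiv_eq]
  have h1 := tiltDiv_pos h.admissible (by linarith)
  have h2 := mul_nonneg hr.le (sub_nonneg.2 h.meanHigh_le)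
  linarith

end RareArm

/-! ### Convergence of arguments from convergence of values -/

/-- If `f` is strictly increasing on an interval `s` and `f ∘ g` converges to `f c`, then `g`
converges to `c`; continuity of `f` is not needed. -/
lemma StrictMonoOn.tendsto_of_tendsto_comp {ι : Type*} {l : Filter ι} {f : ℝ → ℝ} {s : Set ℝ}
    (hf : StrictMonoOn f s) (hs : s.OrdConnected) {g : ι → ℝ} {c : ℝ} (hc : c ∈ s)
    (hg : ∀ᶠ i in l, g i ∈ s) (h : Tendsto (fun i => f (g i)) l (𝓝 (f c))) :
    Tendsto g l (𝓝 c) := by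
  refine tendsto_order.2 ⟨fun a ha => ?_, fun a ha => ?_⟩
  · by_cases hmem : a ∈ s
    · filter_upwards [hg, h.eventually (eventually_gt_nhds (hf hmem hc ha))] with i hi hi'
      exact (hf.lt_iff_lt hmem hi).1 hi'
    · filter_upwards [hg] with i hi
      by_contra! hle
      exact hmem (hs.out hi hc ⟨hle, ha.le⟩)
  · by_cases hmem : a ∈ s
    · filter_upwards [hg, h.eventually (eventually_lt_nhds (hf hc hmem ha))] with i hi hi'
      exact (hf.lt_iff_lt hi hmem).1 hi'
    · filter_upwards [hg] with i hi
      by_contra! hle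
      exact hmem (hs.out hc hi ⟨ha.le, hle⟩)

namespace RareArm

/-! ### Two arms with a common mean in between -/

variable {P A : RareArm}

lemma tendsto_meanLow_atTop : Tendsto P.meanLow atTop (𝓝 0) := by
  have : Tendsto (fun y => ∑ a ∈ P.supp, a * P.p a / (1 + y * a)) atTop
      (𝓝 (∑ _a ∈ P.supp, (0 : ℝ))) := by
    refine tendsto_finsetSum _ fun a ha => Tendsto.const_div_atTop ?_ _
    exact tendsto_atTop_add_const_left _ _ (tendsto_id.atTop_mul_const (P.supp_pos a ha))
  rw [Finset.sum_const_zero] at this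
  exact this

lemma exists_meanLow_eq {x : ℝ} (h0 : 0 < x) (hx : x < P.mean) : ∃ y, 0 < y ∧ P.meanLow y = x := by
  obtain ⟨z, hz0, hz⟩ :=
    ((eventually_ge_atTop (0 : ℝ)).and
      (tendsto_meanLow_atTop.eventually (eventually_lt_nhds h0))).exists
  obtain ⟨y, hy, hyx⟩ := intermediate_value_Icc' hz0
    (continuousOn_meanLow.mono fun _ hy => hy.1)
    (show x ∈ Set.Icc (P.meanLow z) (P.meanLow 0) from ⟨hz.le, by simpa using hx.le⟩)
  refine ⟨y, lt_of_le_of_ne hy.1 fun h => ?_, hyx⟩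
  rw [← h, meanLow_zero] at hyx
  exact hx.ne' hyx

/-- The parameter that lowers the mean of `P` to the mean of `A`, the largest possible value of `y`
(for `A.mean < P.mean`). -/
noncomputable def maxLower (P A : RareArm) : ℝ :=
  Classical.epsilon fun y => 0 < y ∧ P.meanLow y = A.mean

lemma maxLower_spec (h : A.mean < P.mean) :
    0 < maxLower P A ∧ P.meanLow (maxLower P A) = A.mean :=
  Classical.epsilon_spec (exists_meanLow_eq A.mean_pos h)

lemma meanLow_maxLower (h : A.mean < P.mean) : P.meanLow (maxLower P A) = A.mean :=
  (maxLower_spec h).2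

lemma maxLower_pos (h : A.mean < P.mean) : 0 < maxLower P A := (maxLower_spec h).1

lemma strictAntiOn_meanLow : StrictAntiOn P.meanLow (Set.Ici 0) := fun _ hs _ _ hst =>
  meanLow_lt (admissible_of_nonneg hs) hst

lemma mean_le_meanLow_iff (h : A.mean < P.mean) {y : ℝ} (hy : 0 ≤ y) :
    A.mean ≤ P.meanLow y ↔ y ≤ maxLower P A := by
  rw [← meanLow_maxLower h]
  exact strictAntiOn_meanLow.le_iff_ge (maxLower_pos h).le hy

lemma mean_lt_meanLow_iff (h : A.mean < P.mean) {y : ℝ} (hy : 0 ≤ y) :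
    A.mean < P.meanLow y ↔ y < maxLower P A := by
  rw [← meanLow_maxLower h]
  exact strictAntiOn_meanLow.lt_iff_gt (maxLower_pos h).le hy

/-- The parameter `r` that raises the mean of `A` to the mean of `P` lowered by means of `y`. -/
noncomputable def raise (P A : RareArm) (y : ℝ) : ℝ := A.tilt (P.meanLow y)

/-- The divergence of `A` from its version with mean raised to that of `P` lowered by `y`. -/
noncomputable def highDiv (P A : RareArm) (y : ℝ) : ℝ := A.raiseDiv (raise P A y) (P.meanLow y)

/-- The value `f` of the inner problem per unit of weight of the best arm `P`, at the solution with
parameter `y`.  At the largest `y`, where `raise P A y = 0`, the second term is zero by the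
convention on division by zero, which is the correct limit. -/
noncomputable def level (P A : RareArm) (y : ℝ) : ℝ :=
  P.tiltDiv y + y / raise P A y * highDiv P A y

/-- The quotient of the divergences of the two arms from their versions with a common mean. -/
noncomputable def divRatio (P A : RareArm) (y : ℝ) : ℝ := P.tiltDiv y / highDiv P A y

lemma isRaise_iff (h : A.mean < P.mean) {r y : ℝ} :
    (0 ≤ y ∧ A.IsRaise r (P.meanLow y)) ↔ y ∈ Set.Icc 0 (maxLower P A) ∧ r = raise P A y := by
  constructor
  · rintro ⟨h0, hr⟩
    exact ⟨⟨h0, (mean_le_meanLow_iff h h0).1 hr.mean_le⟩, hr.eq_tilt⟩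
  · rintro ⟨hy, rfl⟩
    exact ⟨hy.1, isRaise_tilt ((mean_le_meanLow_iff h hy.1).2 hy.2)⟩

lemma isRaise_raise (h : A.mean < P.mean) {y : ℝ} (hy : y ∈ Set.Icc 0 (maxLower P A)) :
    A.IsRaise (raise P A y) (P.meanLow y) :=
  ((isRaise_iff h).2 ⟨hy, rfl⟩).2

lemma raise_pos (h : A.mean < P.mean) {y : ℝ} (hy : y ∈ Set.Ico 0 (maxLower P A)) :
    0 < raise P A y := tilt_pos ((mean_lt_meanLow_iff h hy.1).2 hy.2)

@[simp] lemma raise_maxLower (h : A.mean < P.mean) : raise P A (maxLower P A) = 0 := by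
  rw [raise, meanLow_maxLower h, tilt_mean]

lemma highDiv_pos (h : A.mean < P.mean) {y : ℝ} (hy : y ∈ Set.Ico 0 (maxLower P A)) :
    0 < highDiv P A y :=
  (isRaise_raise h (Set.Ico_subset_Icc_self hy)).raiseDiv_pos (raise_pos h hy)

lemma highDiv_maxLower (h : A.mean < P.mean) : highDiv P A (maxLower P A) = 0 := by
  simp [highDiv, raiseDiv, h]

lemma continuousOn_raise (h : A.mean < P.mean) :
    ContinuousOn (raise P A) (Set.Icc 0 (maxLower P A)) :=
  continuousOn_tilt.comp (continuousOn_meanLow.mono Set.Icc_subset_Ici_self) fun _ hy =>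
    (mean_le_meanLow_iff h hy.1).2 hy.2

lemma continuousOn_tiltDiv : ContinuousOn P.tiltDiv (Set.Ici 0) := fun _ hy =>
  (continuousAt_tiltDiv (admissible_of_nonneg hy)).continuousWithinAt

lemma continuousOn_highDiv (h : A.mean < P.mean) :
    ContinuousOn (highDiv P A) (Set.Icc 0 (maxLower P A)) := by
  have hm := (continuousOn_meanLow (A := P)).mono
    fun y (hy : y ∈ Set.Icc 0 (maxLower P A)) => hy.1
  refine ContinuousOn.add (fun y hy => ?_) ((continuousOn_raise h).mul hm)
  have h1 := continuousAt_logUp (isRaise_raise h hy).admissible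
  simp only [logDown_eq]
  exact ContinuousAt.comp_continuousWithinAt (f := fun y => -raise P A y) h1
    (continuousOn_raise h y hy).neg

/-- The level at `y` is the value of the inner problem with weights `1` and `y / raise y`, so it is
bounded above by the weighted sum of the divergences at any other common mean. -/
lemma level_le (h : A.mean < P.mean) {y y' : ℝ} (hy : y ∈ Set.Ico 0 (maxLower P A))
    (hy' : y' ∈ Set.Icc 0 (maxLower P A)) :
    level P A y ≤ P.tiltDiv y' + y / raise P A y * highDiv P A y' := by
  have hr := raise_pos h hy
  have h1 := logUp_sub_le_tiltDiv (A := P) hy.1 hy'.1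
  have h2 := (isRaise_raise h (Set.Ico_subset_Icc_self hy)).logDown_add_le_raiseDiv
    (isRaise_raise h hy')
  have h3 := mul_le_mul_of_nonneg_left h2 (div_nonneg hy.1 hr.le)
  have h4 : y / raise P A y * raise P A y = y := div_mul_cancel₀ _ hr.ne'
  have h5 : level P A y = P.logUp y + y / raise P A y * A.logDown (raise P A y) := by
    unfold level highDiv raiseDiv tiltDiv
    linear_combination P.meanLow y * h4
  rw [h5]
  unfold highDiv
  linear_combination h1 + h3 - P.meanLow y' * h4

lemma level_zero : level P A 0 = 0 := by simp [level]

lemma level_maxLower (h : A.mean < P.mean) :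
    level P A (maxLower P A) = P.tiltDiv (maxLower P A) := by
  simp [level, h]

lemma raise_anti (h : A.mean < P.mean) {y y' : ℝ} (hy : 0 ≤ y) (hyy' : y ≤ y')
    (hy' : y' ≤ maxLower P A) : raise P A y' ≤ raise P A y :=
  (isRaise_raise h ⟨hy.trans hyy', hy'⟩).le_of_le (isRaise_raise h ⟨hy, hyy'.trans hy'⟩)
    (strictAntiOn_meanLow.antitoneOn hy (hy.trans hyy') hyy')

lemma strictMonoOn_level (h : A.mean < P.mean) :
    StrictMonoOn (level P A) (Set.Icc 0 (maxLower P A)) := by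
  have key : ∀ {y y' : ℝ}, 0 ≤ y → y < y' → y' < maxLower P A → level P A y < level P A y' := by
    intro y y' h0 hlt hlt'
    have hy : y ∈ Set.Ico 0 (maxLower P A) := ⟨h0, hlt.trans hlt'⟩
    have hy' : y' ∈ Set.Ico 0 (maxLower P A) := ⟨h0.trans hlt.le, hlt'⟩
    refine (level_le h hy (Set.Ico_subset_Icc_self hy')).trans_lt ?_
    unfold level
    have hd := highDiv_pos h hy'
    have : y / raise P A y < y' / raise P A y' :=
      div_lt_div₀ hlt (raise_anti h h0 hlt.le hlt'.le) (h0.trans hlt.le) (raise_pos h hy')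
    gcongr
  intro y hy y' hy' hlt
  rcases lt_or_eq_of_le hy'.2 with h1 | h1
  · exact key hy.1 hlt h1
  · obtain ⟨z, hz1, hz2⟩ := exists_between hlt
    refine (key hy.1 hz1 (h1 ▸ hz2)).trans_le ?_
    have := level_le h (y := z) ⟨hy.1.trans hz1.le, h1 ▸ hz2⟩ hy'
    rw [h1, highDiv_maxLower h, mul_zero, add_zero] at this
    rwa [h1, level_maxLower h]

lemma tiltDiv_le_level (h : A.mean < P.mean) {y : ℝ} (hy : y ∈ Set.Icc 0 (maxLower P A)) :
    P.tiltDiv y ≤ level P A y := by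
  rcases lt_or_eq_of_le hy.2 with h1 | h1
  · have := mul_nonneg (div_nonneg hy.1 (raise_pos h ⟨hy.1, h1⟩).le) (highDiv_pos h ⟨hy.1, h1⟩).le
    unfold level
    linarith
  · rw [h1, level_maxLower h]

lemma continuousOn_level (h : A.mean < P.mean) :
    ContinuousOn (level P A) (Set.Icc 0 (maxLower P A)) := by
  intro y hy
  have ht := (continuousOn_tiltDiv (P := P)).mono
    (fun _ hz => hz.1 : Set.Icc 0 (maxLower P A) ⊆ _) y hy
  rcases lt_or_eq_of_le hy.2 with h1 | h1
  · exact ht.add ((continuousWithinAt_id.div (continuousOn_raise h y hy)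
      (raise_pos h ⟨hy.1, h1⟩).ne').mul (continuousOn_highDiv h y hy))
  · subst h1
    -- Near the end point the quotient `y / raise y` is unbounded; the level is squeezed between
    -- the divergence of `P` and the value at the end point.
    refine tendsto_of_tendsto_of_tendsto_of_le_of_le' (g := P.tiltDiv)
      (h := fun _ => level P A (maxLower P A)) ?_ tendsto_const_nhds ?_ ?_
    · rw [level_maxLower h]
      exact ht
    · filter_upwards [self_mem_nhdsWithin] with z hz
      exact tiltDiv_le_level h hz
    · filter_upwards [self_mem_nhdsWithin] with z hz
      exact (strictMonoOn_level h).monotoneOn hz hy hz.2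

/-! ### The quotient of the divergences -/

lemma divRatio_zero : divRatio P A 0 = 0 := by simp [divRatio]

lemma continuousOn_divRatio (h : A.mean < P.mean) :
    ContinuousOn (divRatio P A) (Set.Ico 0 (maxLower P A)) :=
  (continuousOn_tiltDiv.mono Set.Ico_subset_Ici_self).div
    ((continuousOn_highDiv h).mono Set.Ico_subset_Icc_self) fun _ hy => (highDiv_pos h hy).ne'

lemma strictMonoOn_divRatio (h : A.mean < P.mean) :
    StrictMonoOn (divRatio P A) (Set.Ico 0 (maxLower P A)) := by
  intro y hy y' hy' hlt
  have h1 := strictMonoOn_tiltDiv (A := P) hy.1 hy'.1 hlt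
  have h2 : highDiv P A y' ≤ highDiv P A y := by
    have := (isRaise_raise h (Set.Ico_subset_Icc_self hy')).logDown_add_le_raiseDiv
      (isRaise_raise h (Set.Ico_subset_Icc_self hy))
    refine le_trans ?_ this
    unfold highDiv raiseDiv
    have := mul_le_mul_of_nonneg_left
      (strictAntiOn_meanLow.antitoneOn (f := P.meanLow) hy.1 hy'.1 hlt.le) (raise_pos h hy').le
    linarith
  refine div_lt_div₀ h1 h2 ?_ (highDiv_pos h hy')
  rw [← tiltDiv_zero (A := P)]
  exact strictMonoOn_tiltDiv.monotoneOn (Set.self_mem_Ici) hy'.1 hy'.1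

lemma tendsto_divRatio_atTop (h : A.mean < P.mean) :
    Tendsto (divRatio P A) (𝓝[<] (maxLower P A)) atTop := by
  have hpos := maxLower_pos h
  have hmem : Set.Ico 0 (maxLower P A) ∈ 𝓝[<] (maxLower P A) := Ico_mem_nhdsLT hpos
  have hle : 𝓝[<] (maxLower P A) ≤ 𝓝[Set.Icc 0 (maxLower P A)] (maxLower P A) :=
    nhdsWithin_le_of_mem (mem_of_superset hmem Set.Ico_subset_Icc_self)
  refine Tendsto.pos_mul_atTop (f := P.tiltDiv) (C := P.tiltDiv (maxLower P A))
    (tiltDiv_pos (admissible_of_nonneg hpos.le) hpos.ne') ?_ ?_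
  · exact (continuousAt_tiltDiv (admissible_of_nonneg hpos.le)).tendsto.mono_left
      nhdsWithin_le_nhds
  · refine Tendsto.inv_tendsto_nhdsGT_zero (tendsto_nhdsWithin_iff.2 ⟨?_, ?_⟩)
    · have := continuousOn_highDiv h _ (Set.right_mem_Icc.2 hpos.le)
      rw [ContinuousWithinAt, highDiv_maxLower h] at this
      exact this.mono_left hle
    · filter_upwards [hmem] with y hy
      exact highDiv_pos h hy

/-! ### Parametrization by the level -/

/-- The parameter `y` at which the level is `e`, for `e` in `[0, maxLevel P A]`. -/
noncomputable def lower (P A : RareArm) (e : ℝ) : ℝ :=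
  Classical.epsilon fun y => y ∈ Set.Icc 0 (maxLower P A) ∧ level P A y = e

/-- The largest level, attained at `y = maxLower P A`. -/
noncomputable def maxLevel (P A : RareArm) : ℝ := P.tiltDiv (maxLower P A)

lemma maxLevel_pos (h : A.mean < P.mean) : 0 < maxLevel P A :=
  tiltDiv_pos (admissible_of_nonneg (maxLower_pos h).le) (maxLower_pos h).ne'

lemma lower_spec (h : A.mean < P.mean) {e : ℝ} (he : e ∈ Set.Icc 0 (maxLevel P A)) :
    lower P A e ∈ Set.Icc 0 (maxLower P A) ∧ level P A (lower P A e) = e := by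
  have := intermediate_value_Icc (maxLower_pos h).le (continuousOn_level h)
  rw [level_zero, level_maxLower h] at this
  exact Classical.epsilon_spec (this he)

lemma lower_level (h : A.mean < P.mean) {y : ℝ} (hy : y ∈ Set.Icc 0 (maxLower P A)) :
    level P A y ∈ Set.Icc 0 (maxLevel P A) ∧ lower P A (level P A y) = y := by
  have hm := (strictMonoOn_level h).monotoneOn
  have hl : level P A y ∈ Set.Icc 0 (maxLevel P A) := by
    constructor
    · rw [← level_zero (P := P) (A := A)]
      exact hm (Set.left_mem_Icc.2 (maxLower_pos h).le) hy hy.1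
    · rw [maxLevel, ← level_maxLower h]
      exact hm hy (Set.right_mem_Icc.2 (maxLower_pos h).le) hy.2
  have hs := lower_spec h hl
  exact ⟨hl, (strictMonoOn_level h).injOn hs.1 hy hs.2⟩

@[simp] lemma lower_zero (h : A.mean < P.mean) : lower P A 0 = 0 := by
  simpa [level_zero] using (lower_level h (Set.left_mem_Icc.2 (maxLower_pos h).le)).2

@[simp] lemma lower_maxLevel (h : A.mean < P.mean) : lower P A (maxLevel P A) = maxLower P A := by
  have := (lower_level h (Set.right_mem_Icc.2 (maxLower_pos h).le)).2
  rwa [level_maxLower h] at this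

lemma strictMonoOn_lower (h : A.mean < P.mean) :
    StrictMonoOn (lower P A) (Set.Icc 0 (maxLevel P A)) := by
  intro e he e' he' hlt
  rw [← (lower_spec h he).2, ← (lower_spec h he').2] at hlt
  exact ((strictMonoOn_level h).lt_iff_lt (lower_spec h he).1 (lower_spec h he').1).1 hlt

lemma lower_mem_Ico (h : A.mean < P.mean) {e : ℝ} (he : e ∈ Set.Ico 0 (maxLevel P A)) :
    lower P A e ∈ Set.Ico 0 (maxLower P A) := by
  refine ⟨(lower_spec h (Set.Ico_subset_Icc_self he)).1.1, ?_⟩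
  rw [← lower_maxLevel h]
  exact strictMonoOn_lower h (Set.Ico_subset_Icc_self he)
    (Set.right_mem_Icc.2 (maxLevel_pos h).le) he.2

lemma lower_pos (h : A.mean < P.mean) {e : ℝ} (he : e ∈ Set.Ioc 0 (maxLevel P A)) :
    0 < lower P A e := by
  rw [← lower_zero h]
  exact strictMonoOn_lower h (Set.left_mem_Icc.2 (maxLevel_pos h).le)
    (Set.Ioc_subset_Icc_self he) he.1

/-- The inverse of the level is continuous, since the level is strictly increasing. -/
lemma continuousOn_lower (h : A.mean < P.mean) :
    ContinuousOn (lower P A) (Set.Icc 0 (maxLevel P A)) := by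
  intro e he
  refine (strictMonoOn_level h).tendsto_of_tendsto_comp Set.ordConnected_Icc (lower_spec h he).1
    ?_ ?_
  · filter_upwards [self_mem_nhdsWithin] with z hz
    exact (lower_spec h hz).1
  · rw [(lower_spec h he).2]
    refine Tendsto.congr' ?_ (tendsto_id.mono_left nhdsWithin_le_nhds)
    filter_upwards [self_mem_nhdsWithin] with z hz
    exact (lower_spec h hz).2.symm

/-- `h` as a function of the level. -/
noncomputable def ratioAt (P A : RareArm) (e : ℝ) : ℝ := divRatio P A (lower P A e)

/-- The quotient `y / r` of the parameters as a function of the level: the weight of arm `A`, scaled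
by the rarities, per unit of weight of the best arm `P`. -/
noncomputable def weightAt (P A : RareArm) (e : ℝ) : ℝ := lower P A e / raise P A (lower P A e)

lemma ratioAt_zero (h : A.mean < P.mean) : ratioAt P A 0 = 0 := by
  rw [ratioAt, lower_zero h, divRatio_zero]

lemma strictMonoOn_ratioAt (h : A.mean < P.mean) :
    StrictMonoOn (ratioAt P A) (Set.Ico 0 (maxLevel P A)) := fun _ he _ he' hlt =>
  strictMonoOn_divRatio h (lower_mem_Ico h he) (lower_mem_Ico h he')
    (strictMonoOn_lower h (Set.Ico_subset_Icc_self he) (Set.Ico_subset_Icc_self he') hlt)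

lemma ratioAt_nonneg (h : A.mean < P.mean) {e : ℝ} (he : e ∈ Set.Ico 0 (maxLevel P A)) :
    0 ≤ ratioAt P A e := by
  rw [← ratioAt_zero h]
  exact (strictMonoOn_ratioAt h).monotoneOn (Set.left_mem_Ico.2 (maxLevel_pos h)) he he.1

lemma weightAt_pos (h : A.mean < P.mean) {e : ℝ} (he : e ∈ Set.Ioo 0 (maxLevel P A)) :
    0 < weightAt P A e :=
  div_pos (lower_pos h (Set.Ioo_subset_Ioc_self he))
    (raise_pos h (lower_mem_Ico h (Set.Ioo_subset_Ico_self he)))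

lemma continuousOn_ratioAt (h : A.mean < P.mean) :
    ContinuousOn (ratioAt P A) (Set.Ico 0 (maxLevel P A)) :=
  (continuousOn_divRatio h).comp ((continuousOn_lower h).mono Set.Ico_subset_Icc_self)
    fun _ he => lower_mem_Ico h he

lemma continuousOn_weightAt (h : A.mean < P.mean) :
    ContinuousOn (weightAt P A) (Set.Ico 0 (maxLevel P A)) :=
  ((continuousOn_lower h).mono Set.Ico_subset_Icc_self).div
    ((continuousOn_raise h).comp ((continuousOn_lower h).mono Set.Ico_subset_Icc_self)
      fun _ he => Set.Ico_subset_Icc_self (lower_mem_Ico h he))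
    fun _ he => (raise_pos h (lower_mem_Ico h he)).ne'

lemma tendsto_lower_maxLevel (h : A.mean < P.mean) :
    Tendsto (lower P A) (𝓝[<] (maxLevel P A)) (𝓝[<] (maxLower P A)) := by
  have hmem : Set.Ico 0 (maxLevel P A) ∈ 𝓝[<] (maxLevel P A) := Ico_mem_nhdsLT (maxLevel_pos h)
  refine tendsto_nhdsWithin_iff.2 ⟨?_, ?_⟩
  · have := continuousOn_lower h _ (Set.right_mem_Icc.2 (maxLevel_pos h).le)
    rw [ContinuousWithinAt, lower_maxLevel h] at this
    exact this.mono_left (nhdsWithin_le_of_mem (mem_of_superset hmem Set.Ico_subset_Icc_self))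
  · filter_upwards [hmem] with e he
    exact (lower_mem_Ico h he).2

lemma tendsto_ratioAt_atTop (h : A.mean < P.mean) :
    Tendsto (ratioAt P A) (𝓝[<] (maxLevel P A)) atTop :=
  (tendsto_divRatio_atTop h).comp (tendsto_lower_maxLevel h)

/-! ### Small levels -/

lemma tendsto_lower_zero (h : A.mean < P.mean) :
    Tendsto (lower P A) (𝓝[>] 0) (𝓝[>] 0) := by
  have hmem : Set.Ioc 0 (maxLevel P A) ∈ 𝓝[>] (0 : ℝ) := Ioc_mem_nhdsGT (maxLevel_pos h)
  refine tendsto_nhdsWithin_iff.2 ⟨?_, ?_⟩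
  · have := continuousOn_lower h _ (Set.left_mem_Icc.2 (maxLevel_pos h).le)
    rw [ContinuousWithinAt, lower_zero h] at this
    exact this.mono_left (nhdsWithin_le_of_mem (mem_of_superset hmem Set.Ioc_subset_Icc_self))
  · filter_upwards [hmem] with e he
    exact lower_pos h he

lemma tendsto_nhdsGT_zero_of_continuousOn (h : A.mean < P.mean) {f : ℝ → ℝ}
    (hf : ContinuousOn f (Set.Icc 0 (maxLower P A))) : Tendsto f (𝓝[>] 0) (𝓝 (f 0)) :=
  (hf 0 (Set.left_mem_Icc.2 (maxLower_pos h).le)).mono_left (nhdsWithin_le_of_mem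
    (mem_of_superset (Ioc_mem_nhdsGT (maxLower_pos h)) Set.Ioc_subset_Icc_self))

lemma tendsto_level_div (h : A.mean < P.mean) :
    Tendsto (fun y => level P A y / y) (𝓝[>] 0) (𝓝 (highDiv P A 0 / raise P A 0)) := by
  have hr := tendsto_nhdsGT_zero_of_continuousOn h (continuousOn_raise h)
  have hd := tendsto_nhdsGT_zero_of_continuousOn h (continuousOn_highDiv h)
  have hr0 := raise_pos h (Set.left_mem_Ico.2 (maxLower_pos h))
  have ht : Tendsto (fun y => P.tiltDiv y / y ^ 2 * y) (𝓝[>] 0)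
      (𝓝 (P.secondMoment / 2 * 0)) :=
    (tendsto_tiltDiv_div_sq.mono_left (nhdsGT_le_nhdsNE 0)).mul
      (tendsto_id.mono_left nhdsWithin_le_nhds)
  have := ht.add (hd.div hr hr0.ne')
  rw [mul_zero, zero_add] at this
  refine this.congr' ?_
  filter_upwards [self_mem_nhdsWithin] with y hy
  have hy0 : y ≠ 0 := (Set.mem_Ioi.1 hy).ne'
  simp only [level, Pi.div_apply]
  field_simp

/-- For small levels, the weight ratio is proportional to the level. -/
lemma tendsto_weightAt_div (h : A.mean < P.mean) :
    Tendsto (fun e => weightAt P A e / e) (𝓝[>] 0) (𝓝 (1 / highDiv P A 0)) := by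
  have hr := tendsto_nhdsGT_zero_of_continuousOn h (continuousOn_raise h)
  have hr0 := raise_pos h (Set.left_mem_Ico.2 (maxLower_pos h))
  have hd0 := highDiv_pos h (Set.left_mem_Ico.2 (maxLower_pos h))
  have := ((((tendsto_level_div h).inv₀ (div_pos hd0 hr0).ne').div hr hr0.ne')).comp
    (tendsto_lower_zero h)
  convert this.congr' ?_ using 2
  · field_simp
  · filter_upwards [Ioc_mem_nhdsGT (maxLevel_pos h)] with e he
    have h1 := (lower_spec h (Set.Ioc_subset_Icc_self he)).2
    simp only [Function.comp, Pi.div_apply, h1, weightAt]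
    rw [inv_div, div_right_comm]

/-- For small levels, the ratio of the divergences is quadratic in the level. -/
lemma tendsto_ratioAt_div_sq (h : A.mean < P.mean) :
    Tendsto (fun e => ratioAt P A e / e ^ 2) (𝓝[>] 0)
      (𝓝 (P.secondMoment / 2 * raise P A 0 ^ 2 / highDiv P A 0 ^ 3)) := by
  have hd := tendsto_nhdsGT_zero_of_continuousOn h (continuousOn_highDiv h)
  have hr0 := raise_pos h (Set.left_mem_Ico.2 (maxLower_pos h))
  have hd0 := highDiv_pos h (Set.left_mem_Ico.2 (maxLower_pos h))
  have ht := (tendsto_tiltDiv_div_sq (A := P)).mono_left (nhdsGT_le_nhdsNE 0)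
  have := (((ht.div hd hd0.ne').mul
    (((tendsto_level_div h).inv₀ (div_pos hd0 hr0).ne').pow 2))).comp (tendsto_lower_zero h)
  convert this.congr' ?_ using 2
  · field_simp
  · filter_upwards [Ioc_mem_nhdsGT (maxLevel_pos h)] with e he
    have h1 := (lower_spec h (Set.Ioc_subset_Icc_self he)).2
    have h2 := (lower_pos h he).ne'
    have h3 := he.1.ne'
    simp only [Function.comp, Pi.div_apply, h1, ratioAt, divRatio]
    field_simp

/-! ### Levels close to the largest one -/

/-- Close to the largest level, the ratio of the divergences is inversely quadratic in the
parameter `r` of the arm `A`. -/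
lemma tendsto_ratioAt_mul_sq (h : A.mean < P.mean) :
    Tendsto (fun e => ratioAt P A e * raise P A (lower P A e) ^ 2) (𝓝[<] (maxLevel P A))
      (𝓝 (2 * maxLevel P A / A.secondMoment)) := by
  have hpos := maxLower_pos h
  have hmem : Set.Ico 0 (maxLower P A) ∈ 𝓝[<] (maxLower P A) := Ico_mem_nhdsLT hpos
  have hle : 𝓝[<] (maxLower P A) ≤ 𝓝[Set.Icc 0 (maxLower P A)] (maxLower P A) :=
    nhdsWithin_le_of_mem (mem_of_superset hmem Set.Ico_subset_Icc_self)
  have hr : Tendsto (raise P A) (𝓝[<] (maxLower P A)) (𝓝 0) := by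
    have := continuousOn_raise h _ (Set.right_mem_Icc.2 hpos.le)
    rw [ContinuousWithinAt, raise_maxLower h] at this
    exact this.mono_left hle
  have hneg : Tendsto (fun y => -raise P A y) (𝓝[<] (maxLower P A)) (𝓝[≠] 0) := by
    refine tendsto_nhdsWithin_iff.2 ⟨by simpa using hr.neg, ?_⟩
    filter_upwards [hmem] with y hy
    exact neg_ne_zero.2 (raise_pos h hy).ne'
  have hq := (tendsto_tiltDiv_div_sq (A := A)).comp hneg
  have ht : Tendsto P.tiltDiv (𝓝[<] (maxLower P A)) (𝓝 (maxLevel P A)) :=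
    (continuousAt_tiltDiv (admissible_of_nonneg hpos.le)).tendsto.mono_left nhdsWithin_le_nhds
  have hs := A.secondMoment_pos
  have := (ht.div hq (by positivity)).comp (tendsto_lower_maxLevel h)
  have hsmall : ∀ᶠ e in 𝓝[<] (maxLevel P A), raise P A (lower P A e) * A.B < 1 := by
    have h1 : Tendsto (fun e => raise P A (lower P A e) * A.B) (𝓝[<] (maxLevel P A)) (𝓝 0) := by
      simpa using (hr.comp (tendsto_lower_maxLevel h)).mul_const A.B
    exact h1.eventually (eventually_lt_nhds one_pos)
  convert this.congr' ?_ using 2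
  · field_simp
  · filter_upwards [hsmall, Ico_mem_nhdsLT (maxLevel_pos h)] with e he he'
    have hl := lower_mem_Ico h he'
    have h2 := raise_pos h hl
    have h3 : highDiv P A (lower P A e) = A.tiltDiv (-raise P A (lower P A e)) := by
      -- Without additional mass at `B`, the raised arm is a tilted arm.
      rw [highDiv, raiseDiv_eq,
        (isRaise_raise h (Set.Ico_subset_Icc_self hl)).meanHigh_eq_of_lt he]
      simp
    simp only [Function.comp, Pi.div_apply, ratioAt, divRatio, h3, neg_sq]
    rw [div_div_eq_mul_div, div_mul_eq_mul_div]

/-! ### The first-order condition -/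

/-- The first-order condition: if the common mean with parameter `y` minimizes the weighted sum of
the divergences of the two arms, then the weights are inversely proportional to the parameters. -/
lemma mul_eq_mul_raise_of_isMinOn (h : A.mean < P.mean) {u v y : ℝ} (hu : 0 ≤ u) (hv : 0 ≤ v)
    (hy : y ∈ Set.Ioo 0 (maxLower P A))
    (hmin : IsMinOn (fun z => u * P.tiltDiv z + v * highDiv P A z)
      (Set.Icc 0 (maxLower P A)) y) :
    u * y = v * raise P A y := by
  have hyc := Set.Ioo_subset_Icc_self hy
  have key : ∀ z ∈ Set.Icc 0 (maxLower P A),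
      0 ≤ (v * raise P A z - u * z) * (P.meanLow z - P.meanLow y) := by
    intro z hz
    have h0 : u * P.tiltDiv y + v * highDiv P A y ≤ u * P.tiltDiv z + v * highDiv P A z := hmin hz
    have h1 := mul_le_mul_of_nonneg_left (logUp_sub_le_tiltDiv (A := P) hz.1 hyc.1) hu
    have h2 := mul_le_mul_of_nonneg_left
      ((isRaise_raise h hz).logDown_add_le_raiseDiv (isRaise_raise h hyc)) hv
    have h3 : P.tiltDiv z = P.logUp z - z * P.meanLow z := rfl
    have h4 : highDiv P A z = A.logDown (raise P A z) + raise P A z * P.meanLow z := rfl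
    rw [h3, h4] at h0
    unfold highDiv at h0
    linear_combination h0 + h1 + h2
  have hcont : ContinuousAt (raise P A) y := (continuousOn_raise h).continuousAt
    (Icc_mem_nhds hy.1 hy.2)
  have h1 : Tendsto (fun z => v * raise P A z) (𝓝 y) (𝓝 (v * raise P A y)) := hcont.const_mul v
  have h2 : Tendsto (fun z => u * z) (𝓝 y) (𝓝 (u * y)) := tendsto_id.const_mul u
  apply le_antisymm
  · refine le_of_tendsto_of_tendsto (h2.mono_left (nhdsWithin_le_nhds (s := Set.Iio y)))
      (h1.mono_left nhdsWithin_le_nhds) ?_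
    filter_upwards [Ioo_mem_nhdsLT hy.1] with z hz
    have hlt : P.meanLow y < P.meanLow z := strictAntiOn_meanLow hz.1.le hy.1.le hz.2
    have := nonneg_of_mul_nonneg_left (key z ⟨hz.1.le, (hz.2.trans hy.2).le⟩) (sub_pos.2 hlt)
    linarith
  · refine le_of_tendsto_of_tendsto (h1.mono_left (nhdsWithin_le_nhds (s := Set.Ioi y)))
      (h2.mono_left nhdsWithin_le_nhds) ?_
    filter_upwards [Ioo_mem_nhdsGT hy.2] with z hz
    have hlt : P.meanLow z < P.meanLow y :=
      strictAntiOn_meanLow hy.1.le (hy.1.trans hz.1).le hz.1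
    have hk := key z ⟨(hy.1.trans hz.1).le, hz.2.le⟩
    have := nonneg_of_mul_nonneg_left (a := u * z - v * raise P A z) (by linarith) (sub_pos.2 hlt)
    linarith

end RareArm

namespace RareBandit

open RareArm

variable {n : ℕ} {b : RareBandit n}

/-! ### The inner problem -/

section Inner

variable {γ : ℝ} {w : Fin (n + 2) → ℝ} {i : Fin (n + 2)}

lemma innerValue_le (h : (b.arm i).mean < (b.arm 0).mean) (hγ : 0 < γ) (hw0 : 0 ≤ w 0)
    (hwi : 0 ≤ w i) {y : ℝ} (hy : y ∈ Set.Icc 0 (maxLower (b.arm 0) (b.arm i))) :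
    b.innerValue γ w i ≤ w 0 * γ ^ b.α 0 * (b.arm 0).tiltDiv y +
      w i * γ ^ b.α i * highDiv (b.arm 0) (b.arm i) y := by
  refine csInf_le ⟨0, ?_⟩ ?_
  · rintro v ⟨q₀, q, hq₀, hq, -, rfl⟩
    have := poissonKL_nonneg hq₀
    have := poissonKL_nonneg hq
    positivity
  · obtain ⟨q, hq, hm, hd⟩ := (isRaise_raise h hy).exists_alternative
    have hadm := admissible_of_nonneg (A := b.arm 0) hy.1
    refine ⟨(b.arm 0).tilted y 0, q, isAlternative_tilted hadm le_rfl, hq, ?_, ?_⟩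
    · rw [hm, altMean_tilted, mul_zero, add_zero]
    · rw [hd, poissonKL_tilted hadm (by simp), mul_zero, add_zero]
      rfl

/-- Weak duality for the inner problem: the bounds for the two arms combine if the weights are
inversely proportional to the parameters. -/
lemma le_innerValue (h : (b.arm i).mean < (b.arm 0).mean) (hγ : 0 < γ) (hw0 : 0 ≤ w 0)
    (hwi : 0 ≤ w i) {y : ℝ} (hy : y ∈ Set.Icc 0 (maxLower (b.arm 0) (b.arm i)))
    (hwy : w 0 * γ ^ b.α 0 * y = w i * γ ^ b.α i * raise (b.arm 0) (b.arm i) y) :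
    w 0 * γ ^ b.α 0 * (b.arm 0).tiltDiv y +
      w i * γ ^ b.α i * highDiv (b.arm 0) (b.arm i) y ≤ b.innerValue γ w i := by
  have hadm := admissible_of_nonneg (A := b.arm 0) hy.1
  refine le_csInf ?_ ?_
  · obtain ⟨q, hq, hm, -⟩ := (isRaise_raise h hy).exists_alternative
    exact ⟨_, (b.arm 0).tilted y 0, q, isAlternative_tilted hadm le_rfl, hq,
      by rw [hm, altMean_tilted, mul_zero, add_zero], rfl⟩
  · rintro v ⟨q₀, q, hq₀, hq, hm, rfl⟩
    have hB := (b.arm 0).B_pos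
    have hu : 0 ≤ w 0 * γ ^ b.α 0 := by positivity
    have hv : 0 ≤ w i * γ ^ b.α i := by positivity
    have h1 := mul_le_mul_of_nonneg_left (logUp_sub_le_poissonKL hq₀ hadm
      (by have := mul_nonneg hy.1 hB.le; linarith)) hu
    have h2 := mul_le_mul_of_nonneg_left ((isRaise_raise h hy).logDown_add_le hq) hv
    have h3 := mul_le_mul_of_nonneg_left hm (mul_nonneg hu hy.1)
    unfold tiltDiv highDiv raiseDiv
    linear_combination h1 + h2 + h3 - (b.arm 0).meanLow y * hwy +
      (b.arm i).altMean q * hwy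

end Inner

/-! ### The optimal weights -/

/-- The factors `γ ^ (α 0 - α i)` compare the rarities of the arms. -/
noncomputable def rarity (b : RareBandit n) (γ : ℝ) (i : Fin (n + 2)) : ℝ := γ ^ (b.α 0 - b.α i)

/-- The quotient of the divergences of the arms `0` and `i`, as a function of the level. -/
noncomputable def ratio (b : RareBandit n) (i : Fin (n + 2)) (e : ℝ) : ℝ :=
  ratioAt (b.arm 0) (b.arm i) e

/-- The quotient `y_i / r_i` as a function of the level: up to the factor `rarity`, the weight of
arm `i` relative to arm `0`. -/
noncomputable def weight (b : RareBandit n) (i : Fin (n + 2)) (e : ℝ) : ℝ :=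
  weightAt (b.arm 0) (b.arm i) e

/-- The sum of all weights relative to that of arm `0`. -/
noncomputable def totalWeight (b : RareBandit n) (γ e : ℝ) : ℝ :=
  1 + ∑ i ∈ Finset.univ.erase 0, b.rarity γ i * b.weight i e

/-- The weights in the simplex for which all inner values have the common level `e`. -/
noncomputable def levelWeights (b : RareBandit n) (γ e : ℝ) (i : Fin (n + 2)) : ℝ :=
  (if i = 0 then 1 else b.rarity γ i * b.weight i e) / b.totalWeight γ e

/-- The largest common level, which is the largest level of the second best arm. -/
noncomputable def topLevel (b : RareBandit n) : ℝ := maxLevel (b.arm 0) (b.arm 1)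

lemma rarity_pos {γ : ℝ} (hγ : 0 < γ) (i : Fin (n + 2)) : 0 < b.rarity γ i :=
  Real.rpow_pos_of_pos hγ _

lemma rpow_mul_rarity {γ : ℝ} (hγ : 0 < γ) (i : Fin (n + 2)) :
    γ ^ b.α i * b.rarity γ i = γ ^ b.α 0 := by
  rw [rarity, ← Real.rpow_add hγ]
  congr 1
  ring

lemma topLevel_lt (hbest : ∀ i, i ≠ 0 → (b.arm i).mean < (b.arm 0).mean)
    (hsecond : ∀ i, i ≠ 0 → i ≠ 1 → (b.arm i).mean < (b.arm 1).mean)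
    {i : Fin (n + 2)} (hi : i ≠ 0) (hi1 : i ≠ 1) :
    b.topLevel < maxLevel (b.arm 0) (b.arm i) := by
  have h1 := hbest 1 (by simp)
  have hi0 := hbest i hi
  refine strictMonoOn_tiltDiv (maxLower_pos h1).le (maxLower_pos hi0).le ?_
  refine (mean_lt_meanLow_iff hi0 (maxLower_pos h1).le).1 ?_
  rw [meanLow_maxLower h1]
  exact hsecond i hi hi1

lemma topLevel_le (hbest : ∀ i, i ≠ 0 → (b.arm i).mean < (b.arm 0).mean)
    (hsecond : ∀ i, i ≠ 0 → i ≠ 1 → (b.arm i).mean < (b.arm 1).mean)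
    {i : Fin (n + 2)} (hi : i ≠ 0) : b.topLevel ≤ maxLevel (b.arm 0) (b.arm i) := by
  by_cases hi1 : i = 1
  · rw [hi1, topLevel]
  · exact (topLevel_lt hbest hsecond hi hi1).le

section Optimal

variable (hbest : ∀ i, i ≠ 0 → (b.arm i).mean < (b.arm 0).mean)
  (hsecond : ∀ i, i ≠ 0 → i ≠ 1 → (b.arm i).mean < (b.arm 1).mean)
include hbest hsecond

lemma Ico_subset {i : Fin (n + 2)} (hi : i ≠ 0) :
    Set.Ico 0 b.topLevel ⊆ Set.Ico 0 (maxLevel (b.arm 0) (b.arm i)) :=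
  Set.Ico_subset_Ico_right (topLevel_le hbest hsecond hi)

lemma weight_pos {i : Fin (n + 2)} (hi : i ≠ 0) {e : ℝ} (he : e ∈ Set.Ioo 0 b.topLevel) :
    0 < b.weight i e :=
  weightAt_pos (hbest i hi) ⟨he.1, he.2.trans_le (topLevel_le hbest hsecond hi)⟩

lemma totalWeight_pos {γ e : ℝ} (hγ : 0 < γ) (he : e ∈ Set.Ioo 0 b.topLevel) :
    0 < b.totalWeight γ e := by
  refine add_pos_of_pos_of_nonneg one_pos (Finset.sum_nonneg fun i hi => ?_)
  exact (mul_pos (rarity_pos hγ i) (weight_pos hbest hsecond (Finset.ne_of_mem_erase hi) he)).le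

lemma levelWeights_mem_stdSimplex {γ e : ℝ} (hγ : 0 < γ) (he : e ∈ Set.Ioo 0 b.topLevel) :
    b.levelWeights γ e ∈ stdSimplex ℝ (Fin (n + 2)) := by
  have hS := totalWeight_pos hbest hsecond hγ he
  refine ⟨fun i => div_nonneg ?_ hS.le, ?_⟩
  · split_ifs with hi
    · exact zero_le_one
    · exact (mul_pos (rarity_pos hγ i) (weight_pos hbest hsecond hi he)).le
  · unfold levelWeights
    rw [← Finset.sum_div, div_eq_one_iff_eq hS.ne', ← Finset.add_sum_erase _ _ (Finset.mem_univ 0),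
      if_pos rfl, totalWeight]
    congr 1
    exact Finset.sum_congr rfl fun i hi => if_neg (Finset.ne_of_mem_erase hi)

/-- The optimal weights: at the level `e` with `∑ γ ^ (α 0 - α i) h_i(e) = 1`, the bounds by the
pairs of alternatives with that level, averaged with the multipliers
`γ ^ (α 0 - α i) / highDiv_i`, do not depend on the weights, and they are attained by the level
weights only. -/
theorem isOptimal_iff {γ e : ℝ} (hγ : 0 < γ) (he : e ∈ Set.Ioo 0 b.topLevel)
    (hsum : ∑ i ∈ Finset.univ.erase 0, b.rarity γ i * b.ratio i e = 1)
    (w : Fin (n + 2) → ℝ) : b.IsOptimal γ w ↔ w = b.levelWeights γ e := by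
  set y : Fin (n + 2) → ℝ := fun i => lower (b.arm 0) (b.arm i) e with hy
  set d : Fin (n + 2) → ℝ := fun i => (b.arm 0).tiltDiv (y i) with hd
  set D : Fin (n + 2) → ℝ := fun i => highDiv (b.arm 0) (b.arm i) (y i) with hD
  have hei : ∀ i, i ≠ 0 → e ∈ Set.Ioo 0 (maxLevel (b.arm 0) (b.arm i)) := fun i hi =>
    ⟨he.1, he.2.trans_le (topLevel_le hbest hsecond hi)⟩
  have hyi : ∀ i, i ≠ 0 → y i ∈ Set.Ioo 0 (maxLower (b.arm 0) (b.arm i)) := fun i hi =>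
    ⟨lower_pos (hbest i hi) (Set.Ioo_subset_Ioc_self (hei i hi)),
      (lower_mem_Ico (hbest i hi) (Set.Ioo_subset_Ico_self (hei i hi))).2⟩
  have hDpos : ∀ i, i ≠ 0 → 0 < D i := fun i hi =>
    highDiv_pos (hbest i hi) (Set.Ioo_subset_Ico_self (hyi i hi))
  have hrpos : ∀ i, i ≠ 0 → 0 < raise (b.arm 0) (b.arm i) (y i) := fun i hi =>
    raise_pos (hbest i hi) (Set.Ioo_subset_Ico_self (hyi i hi))
  have hlev : ∀ i, i ≠ 0 → d i + b.weight i e * D i = e := fun i hi =>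
    (lower_spec (hbest i hi) (Set.Ioo_subset_Icc_self (hei i hi))).2
  have hg : 0 < γ ^ b.α 0 := Real.rpow_pos_of_pos hγ _
  have hS := totalWeight_pos hbest hsecond hγ he
  -- The multipliers and their sum.
  set l : Fin (n + 2) → ℝ := fun i => b.rarity γ i / D i with hl
  have hlpos : ∀ i, i ≠ 0 → 0 < l i := fun i hi => div_pos (rarity_pos hγ i) (hDpos i hi)
  have hlsum : (∑ i ∈ Finset.univ.erase 0, l i) * e = b.totalWeight γ e := by
    rw [totalWeight, ← hsum, ← Finset.sum_add_distrib, Finset.sum_mul]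
    refine Finset.sum_congr rfl fun i hi => ?_
    have hi0 := Finset.ne_of_mem_erase hi
    have h1 := (hDpos i hi0).ne'
    have h2 : b.ratio i e = d i / D i := rfl
    have h3 : b.rarity γ i / D i * e = b.rarity γ i / D i * (d i + b.weight i e * D i) := by
      rw [hlev i hi0]
    rw [h2]
    simp only [hl]
    rw [h3]
    field_simp
  set V : ℝ := γ ^ b.α 0 * e / b.totalWeight γ e with hV
  have hlV : ∑ i ∈ Finset.univ.erase 0, l i * V = γ ^ b.α 0 := by
    rw [← Finset.sum_mul, hV, mul_div_assoc', div_eq_iff hS.ne', ← hlsum]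
    ring
  -- The averaged bounds do not depend on the weights.
  have havg : ∀ w ∈ stdSimplex ℝ (Fin (n + 2)), ∑ i ∈ Finset.univ.erase 0,
      l i * (w 0 * γ ^ b.α 0 * d i + w i * γ ^ b.α i * D i) = γ ^ b.α 0 := by
    intro w hw
    have h1 : ∀ i ∈ Finset.univ.erase (0 : Fin (n + 2)),
        l i * (w 0 * γ ^ b.α 0 * d i + w i * γ ^ b.α i * D i) =
          w 0 * γ ^ b.α 0 * (b.rarity γ i * b.ratio i e) + γ ^ b.α 0 * w i := fun i hi => by
      have h1 := (hDpos i (Finset.ne_of_mem_erase hi)).ne'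
      have h2 : b.ratio i e = d i / D i := rfl
      rw [h2, ← rpow_mul_rarity hγ i]
      simp only [hl]
      field_simp
    rw [Finset.sum_congr rfl h1, Finset.sum_add_distrib, ← Finset.mul_sum, ← Finset.mul_sum, hsum]
    have h2 := hw.2
    rw [← Finset.add_sum_erase _ _ (Finset.mem_univ 0)] at h2
    linear_combination γ ^ b.α 0 * h2
  have : Nonempty {i : Fin (n + 2) // i ≠ 0} := ⟨⟨1, by simp⟩⟩
  have hobj : ∀ (w : Fin (n + 2) → ℝ) (i : Fin (n + 2)), i ≠ 0 →
      b.objective γ w ≤ b.innerValue γ w i := fun w i hi =>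
    ciInf_le (f := fun j : {j : Fin (n + 2) // j ≠ 0} => b.innerValue γ w j)
      (Set.finite_range _).bddBelow ⟨i, hi⟩
  have hinner : ∀ w ∈ stdSimplex ℝ (Fin (n + 2)), ∀ i, i ≠ 0 →
      b.innerValue γ w i ≤ w 0 * γ ^ b.α 0 * d i + w i * γ ^ b.α i * D i := fun w hw i hi =>
    innerValue_le (hbest i hi) hγ (hw.1 0) (hw.1 i) (Set.Ioo_subset_Icc_self (hyi i hi))
  have hle : ∀ w ∈ stdSimplex ℝ (Fin (n + 2)), b.objective γ w ≤ V := by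
    intro w hw
    by_contra! hlt
    have h1 : ∑ i ∈ Finset.univ.erase 0, l i * V < ∑ i ∈ Finset.univ.erase 0,
        l i * (w 0 * γ ^ b.α 0 * d i + w i * γ ^ b.α i * D i) := by
      refine Finset.sum_lt_sum_of_nonempty ⟨1, by simp⟩ fun i hi => ?_
      have hi0 := Finset.ne_of_mem_erase hi
      exact mul_lt_mul_of_pos_left (hlt.trans_le ((hobj w i hi0).trans (hinner w hw i hi0)))
        (hlpos i hi0)
    rw [hlV, havg w hw] at h1
    exact lt_irrefl _ h1
  have hmem := levelWeights_mem_stdSimplex hbest hsecond hγ he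
  have hge : V ≤ b.objective γ (b.levelWeights γ e) := by
    refine le_ciInf fun ⟨i, hi⟩ => ?_
    have h0 : b.levelWeights γ e 0 = 1 / b.totalWeight γ e := by simp [levelWeights]
    have h1 : b.levelWeights γ e i * γ ^ b.α i =
        γ ^ b.α 0 * b.weight i e / b.totalWeight γ e := by
      rw [levelWeights, if_neg hi, ← rpow_mul_rarity hγ i]
      ring
    refine le_trans (le_of_eq ?_) (le_innerValue (hbest i hi) hγ (hmem.1 0) (hmem.1 i)
      (Set.Ioo_subset_Icc_self (hyi i hi)) ?_)
    · rw [h0, h1, hV]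
      nth_rewrite 1 [← hlev i hi]
      simp only [hd, hD]
      ring
    · have h2 : b.weight i e * raise (b.arm 0) (b.arm i) (y i) = y i :=
        div_mul_cancel₀ _ (hrpos i hi).ne'
      rw [h0, h1]
      linear_combination -(γ ^ b.α 0 / b.totalWeight γ e) * h2
  constructor
  · rintro ⟨hw, hmax⟩
    have hVw : V ≤ b.objective γ w := hge.trans (hmax hmem)
    -- All the averaged bounds are tight.
    have htight : ∀ i ∈ Finset.univ.erase (0 : Fin (n + 2)),
        l i * V = l i * (w 0 * γ ^ b.α 0 * d i + w i * γ ^ b.α i * D i) := by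
      refine (Finset.sum_eq_sum_iff_of_le fun i hi => ?_).1 (by rw [hlV, havg w hw])
      have hi0 := Finset.ne_of_mem_erase hi
      exact mul_le_mul_of_nonneg_left (hVw.trans ((hobj w i hi0).trans (hinner w hw i hi0)))
        (hlpos i hi0).le
    have hwi : ∀ i, i ≠ 0 → w i = w 0 * (b.rarity γ i * b.weight i e) := by
      intro i hi
      have h1 := mul_left_cancel₀ (hlpos i hi).ne'
        (htight i (Finset.mem_erase.2 ⟨hi, Finset.mem_univ i⟩))
      have hgi : 0 < γ ^ b.α i := Real.rpow_pos_of_pos hγ _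
      have h2 := mul_eq_mul_raise_of_isMinOn (hbest i hi) (u := w 0 * γ ^ b.α 0)
        (v := w i * γ ^ b.α i) (mul_nonneg (hw.1 0) hg.le) (mul_nonneg (hw.1 i) hgi.le)
        (hyi i hi) fun z hz => by
          refine le_trans (h1.symm.le.trans (hVw.trans (hobj w i hi))) ?_
          exact innerValue_le (hbest i hi) hγ (hw.1 0) (hw.1 i) hz
      have h3 : b.weight i e = y i / raise (b.arm 0) (b.arm i) (y i) := rfl
      have h4 := (hrpos i hi).ne'
      rw [h3]
      rw [← rpow_mul_rarity hγ i] at h2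
      have h5 : w 0 * b.rarity γ i * y i = w i * raise (b.arm 0) (b.arm i) (y i) :=
        mul_left_cancel₀ hgi.ne' (by linear_combination h2)
      field_simp
      linear_combination -h5
    have hw0 : w 0 * b.totalWeight γ e = 1 := by
      have h2 := hw.2
      rw [← Finset.add_sum_erase _ _ (Finset.mem_univ 0),
        Finset.sum_congr rfl fun i hi => hwi i (Finset.ne_of_mem_erase hi), ← Finset.mul_sum] at h2
      rw [totalWeight, mul_add, mul_one, h2]
    ext i
    rw [levelWeights, eq_div_iff hS.ne']
    split_ifs with hi
    · rw [hi, hw0]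
    · rw [hwi i hi]
      linear_combination (b.rarity γ i * b.weight i e) * hw0
  · rintro rfl
    exact ⟨hmem, fun w hw => (hle w hw).trans hge⟩

/-! ### The level that balances the ratios of the divergences -/

lemma strictMonoOn_sum_ratio {c : Fin (n + 2) → ℝ} (hc : ∀ i, i ≠ 0 → 0 ≤ c i)
    (hc' : ∃ i, i ≠ 0 ∧ 0 < c i) :
    StrictMonoOn (fun e => ∑ i ∈ Finset.univ.erase 0, c i * b.ratio i e)
      (Set.Ico 0 b.topLevel) := by
  intro e he e' he' hlt
  have hm : ∀ i, i ≠ 0 → b.ratio i e < b.ratio i e' := fun i hi =>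
    strictMonoOn_ratioAt (hbest i hi) (Ico_subset hbest hsecond hi he)
      (Ico_subset hbest hsecond hi he') hlt
  obtain ⟨k, hk, hck⟩ := hc'
  refine Finset.sum_lt_sum (fun i hi => ?_) ⟨k, by simpa using hk, ?_⟩
  · have hi0 := Finset.ne_of_mem_erase hi
    exact mul_le_mul_of_nonneg_left (hm i hi0).le (hc i hi0)
  · exact mul_lt_mul_of_pos_left (hm k hk) hck

/-- The factors `c` are those of the balance condition at a fixed rarity, or the indicator of the
rarest arms. -/
lemma exists_sum_ratio_eq_one {c : Fin (n + 2) → ℝ} {e' : ℝ} (he' : e' ∈ Set.Ico 0 b.topLevel)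
    (h : 1 ≤ ∑ i ∈ Finset.univ.erase 0, c i * b.ratio i e') :
    ∃ e ∈ Set.Ioo 0 b.topLevel, ∑ i ∈ Finset.univ.erase 0, c i * b.ratio i e = 1 := by
  have h0 : ∑ i ∈ Finset.univ.erase 0, c i * b.ratio i 0 = 0 :=
    Finset.sum_eq_zero fun i hi => by
      rw [ratio, ratioAt_zero (hbest i (Finset.ne_of_mem_erase hi)), mul_zero]
  have hcont : ContinuousOn (fun e => ∑ i ∈ Finset.univ.erase 0, c i * b.ratio i e)
      (Set.Icc 0 e') := by
    refine continuousOn_finsetSum _ fun i hi => continuousOn_const.mul ?_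
    have hi0 := Finset.ne_of_mem_erase hi
    exact (continuousOn_ratioAt (hbest i hi0)).mono fun z hz =>
      Ico_subset hbest hsecond hi0 ⟨hz.1, hz.2.trans_lt he'.2⟩
  obtain ⟨e, he, he1⟩ := intermediate_value_Icc he'.1 hcont
    (show (1 : ℝ) ∈ Set.Icc _ _ from ⟨by simp only [h0]; exact zero_le_one, h⟩)
  refine ⟨e, ⟨lt_of_le_of_ne he.1 fun h' => ?_, he.2.trans_lt he'.2⟩, he1⟩
  simp only [← h', h0] at he1
  exact zero_ne_one he1

/-- The level of the optimal weights exists, since the ratio of the divergences of the second best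
arm is unbounded. -/
lemma exists_level {γ : ℝ} (hγ : 0 < γ) :
    ∃ e ∈ Set.Ioo 0 b.topLevel, ∑ i ∈ Finset.univ.erase 0, b.rarity γ i * b.ratio i e = 1 := by
  have h1 := hbest 1 (by simp)
  have hc := rarity_pos (b := b) hγ
  obtain ⟨e, he, hle⟩ := ((tendsto_ratioAt_atTop h1).eventually_ge_atTop (1 / b.rarity γ 1)).and
    (Ico_mem_nhdsLT (maxLevel_pos h1)) |>.exists
  refine exists_sum_ratio_eq_one hbest hsecond hle ?_
  refine le_trans ?_ (Finset.single_le_sum (f := fun i => b.rarity γ i * b.ratio i e)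
    (fun i hi => ?_) (show (1 : Fin (n + 2)) ∈ _ by simp))
  · rw [div_le_iff₀ (hc 1)] at he
    rw [mul_comm]
    exact he
  · have hi0 := Finset.ne_of_mem_erase hi
    exact mul_nonneg (hc i).le (ratioAt_nonneg (hbest i hi0) (Ico_subset hbest hsecond hi0 hle))

/-! ### Profiles -/

omit hsecond in
lemma isG_iff {i : Fin (n + 2)} (hi : i ≠ 0) {r y : ℝ} :
    b.IsG i r y ↔
      y ∈ Set.Icc 0 (maxLower (b.arm 0) (b.arm i)) ∧ r = raise (b.arm 0) (b.arm i) y :=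
  isRaise_iff (hbest i hi)

omit hsecond in
/-- The two formulas for `f_i` agree, also at `r = 0`. -/
lemma f_eq_level {i : Fin (n + 2)} (hi : i ≠ 0) {y : ℝ}
    (hy : y ∈ Set.Icc 0 (maxLower (b.arm 0) (b.arm i))) :
    b.f i (raise (b.arm 0) (b.arm i) y) y = level (b.arm 0) (b.arm i) y := by
  have h := hbest i hi
  rcases lt_or_eq_of_le hy.2 with h1 | h1
  · have hr := raise_pos h ⟨hy.1, h1⟩
    rw [f, if_neg hr.ne', level, highDiv, raiseDiv, tiltDiv]
    field_simp
    ring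
  · rw [h1, level_maxLower h, raise_maxLower h, f, if_pos rfl, tiltDiv, meanLow_maxLower h]
    rfl

end Optimal

/-- The profile with the common level `e`, for `e` in `[0, topLevel]`. -/
noncomputable def profileAt (b : RareBandit n) (e : ℝ) (i : Fin (n + 2)) : ℝ × ℝ :=
  if i = 0 then 0
  else (raise (b.arm 0) (b.arm i) (lower (b.arm 0) (b.arm i) e), lower (b.arm 0) (b.arm i) e)

lemma profileAt_of_ne {i : Fin (n + 2)} (hi : i ≠ 0) (e : ℝ) : b.profileAt e i =
    (raise (b.arm 0) (b.arm i) (lower (b.arm 0) (b.arm i) e), lower (b.arm 0) (b.arm i) e) :=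
  if_neg hi

lemma mem_rarest {i : Fin (n + 2)} : i ∈ b.rarest ↔ i ≠ 0 ∧ b.α i = b.αmax := by
  simp [rarest]

lemma ratioSum_profileAt (e : ℝ) : b.ratioSum (b.profileAt e) = ∑ i ∈ b.rarest, b.ratio i e := by
  refine Finset.sum_congr rfl fun i hi => ?_
  rw [profileAt_of_ne (mem_rarest.1 hi).1]
  rfl

lemma limProfile_profileAt (e : ℝ) (i : Fin (n + 2)) : b.limProfile (b.profileAt e) i =
    (if i = 0 then 1 else b.weight i e) / (1 + ∑ k ∈ b.rarest, b.weight k e) := by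
  unfold limProfile
  congr 1
  · split_ifs with hi
    · rfl
    · rw [profileAt_of_ne hi]
      rfl
  · congr 1
    refine Finset.sum_congr rfl fun k hk => ?_
    rw [profileAt_of_ne (mem_rarest.1 hk).1]
    rfl

lemma sum_rarest_eq (F : Fin (n + 2) → ℝ) : ∑ i ∈ b.rarest, F i =
    ∑ i ∈ Finset.univ.erase 0, (if b.α i = b.αmax then 1 else 0) * F i := by
  simp_rw [ite_mul, one_mul, zero_mul]
  rw [← Finset.sum_filter]
  refine Finset.sum_congr ?_ fun _ _ => rfl
  ext i
  simp [rarest]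

section Profiles

variable (hbest : ∀ i, i ≠ 0 → (b.arm i).mean < (b.arm 0).mean)
  (hsecond : ∀ i, i ≠ 0 → i ≠ 1 → (b.arm i).mean < (b.arm 1).mean)
include hbest hsecond

/-- Profiles are parametrized by their common level. -/
theorem isProfile_iff {q : Fin (n + 2) → ℝ × ℝ} :
    b.IsProfile q ↔ ∃ e ∈ Set.Icc 0 b.topLevel, q = b.profileAt e := by
  constructor
  · rintro ⟨h0, hG, hl⟩
    have h1 := hbest 1 (by simp)
    have hl' : ∀ i, i ≠ 0 → level (b.arm 0) (b.arm i) (q i).2 = b.f 1 (q 1).1 (q 1).2 :=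
      fun i hi => by
        obtain ⟨hy, hr⟩ := (isG_iff hbest hi).1 (hG i hi)
        rw [← hl i hi, hr, f_eq_level hbest hi hy]
    refine ⟨b.f 1 (q 1).1 (q 1).2, ?_, ?_⟩
    · rw [← hl' 1 (by simp)]
      exact (lower_level h1 ((isG_iff hbest (by simp)).1 (hG 1 (by simp))).1).1
    · ext1 i
      by_cases hi : i = 0
      · rw [hi, h0, profileAt, if_pos rfl]
      · obtain ⟨hy, hr⟩ := (isG_iff hbest hi).1 (hG i hi)
        rw [profileAt_of_ne hi, ← hl' i hi, (lower_level (hbest i hi) hy).2, ← hr]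
  · rintro ⟨e, he, rfl⟩
    have hspec : ∀ i : Fin (n + 2), i ≠ 0 → _ := fun i hi => lower_spec (hbest i hi)
      ⟨he.1, he.2.trans (topLevel_le hbest hsecond hi)⟩
    have hf : ∀ i, i ≠ 0 → b.f i (b.profileAt e i).1 (b.profileAt e i).2 = e := fun i hi => by
      rw [profileAt_of_ne hi, f_eq_level hbest hi (hspec i hi).1, (hspec i hi).2]
    refine ⟨if_pos rfl, fun i hi => ?_, fun i hi => ?_⟩
    · rw [profileAt_of_ne hi]
      exact (isG_iff hbest hi).2 ⟨(hspec i hi).1, rfl⟩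
    · rw [hf i hi, hf 1 (by simp)]

/-- The profile `ξ` is the one with the largest level. -/
theorem isXiZero_iff {q : Fin (n + 2) → ℝ × ℝ} :
    b.IsXiZero q ↔ q = b.profileAt b.topLevel := by
  have h1 := hbest 1 (by simp)
  constructor
  · rintro ⟨hq, hr⟩
    obtain ⟨e, he, rfl⟩ := (isProfile_iff hbest hsecond).1 hq
    rcases lt_or_eq_of_le he.2 with h | h
    · rw [profileAt_of_ne (by simp)] at hr
      exact absurd hr (raise_pos h1 (lower_mem_Ico h1 ⟨he.1, h⟩)).ne'
    · rw [h]
  · rintro rfl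
    refine ⟨(isProfile_iff hbest hsecond).2
      ⟨_, ⟨(maxLevel_pos h1).le, le_rfl⟩, rfl⟩, ?_⟩
    rw [profileAt_of_ne (by simp), topLevel, lower_maxLevel h1]
    exact raise_maxLower h1

lemma strictMonoOn_sum_rarest (hne : b.rarest.Nonempty) :
    StrictMonoOn (fun e => ∑ i ∈ b.rarest, b.ratio i e) (Set.Ico 0 b.topLevel) := by
  obtain ⟨k, hk⟩ := hne
  simp_rw [sum_rarest_eq]
  exact strictMonoOn_sum_ratio hbest hsecond (fun i _ => by split_ifs <;> simp)
    ⟨k, (mem_rarest.1 hk).1, by simp [(mem_rarest.1 hk).2]⟩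

/-- Unless the sum of the `h_i` equals one at `ξ`, a balanced profile has a level below the
largest one, and there is at most one. -/
theorem isBalanced_iff (hxi : b.ratioSum (b.profileAt b.topLevel) ≠ 1) {e : ℝ}
    (he : e ∈ Set.Ioo 0 b.topLevel) (h : ∑ i ∈ b.rarest, b.ratio i e = 1) :
    ∀ q, b.IsBalanced q ↔ q = b.profileAt e := by
  have hne : b.rarest.Nonempty := by
    by_contra hemp
    rw [Finset.not_nonempty_iff_eq_empty.1 hemp, Finset.sum_empty] at h
    exact zero_ne_one h
  have hmono := strictMonoOn_sum_rarest hbest hsecond hne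
  intro q
  constructor
  · rintro ⟨hq, hs⟩
    obtain ⟨e', he', rfl⟩ := (isProfile_iff hbest hsecond).1 hq
    have hlt : e' < b.topLevel := lt_of_le_of_ne he'.2 fun h' => hxi (h' ▸ hs)
    rw [ratioSum_profileAt, ← h] at hs
    rw [hmono.injOn ⟨he'.1, hlt⟩ (Set.Ioo_subset_Ico_self he) hs]
  · rintro rfl
    exact ⟨(isProfile_iff hbest hsecond).2 ⟨e, Set.Ioo_subset_Icc_self he, rfl⟩,
      by rw [ratioSum_profileAt, h]⟩

end Profiles

/-! ### Limits along vanishing rarity -/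

lemma HasScaledLimit.hasOrder {u : ℝ → ℝ} {e L : ℝ} (h : HasScaledLimit u e L) (hL : L ≠ 0) :
    HasOrder u e L :=
  ⟨(isTheta_of_div_tendsto_nhds_ne_zero h hL).symm, h⟩

lemma α_le_αmax (i : Fin (n + 2)) : b.α i ≤ b.αmax := Finset.le_sup' b.α (Finset.mem_univ i)

lemma tendsto_rpow_zero {δ : ℝ} (hδ : 0 < δ) :
    Tendsto (fun γ : ℝ => γ ^ δ) (𝓝[>] 0) (𝓝 0) := by
  have := (Real.continuousAt_rpow_const 0 δ (Or.inr hδ.le)).tendsto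
  rw [Real.zero_rpow hδ.ne'] at this
  exact this.mono_left nhdsWithin_le_nhds

lemma tendsto_rpow_αmax_sub (i : Fin (n + 2)) : Tendsto (fun γ : ℝ => γ ^ (b.αmax - b.α i))
    (𝓝[>] 0) (𝓝 (if b.α i = b.αmax then 1 else 0)) := by
  split_ifs with h
  · simp [h]
  · exact tendsto_rpow_zero (sub_pos.2 (lt_of_le_of_ne (α_le_αmax i) h))

/-- Only the rarest arms contribute to the limit of a sum with the factors `γ ^ (αmax - α i)`. -/
lemma tendsto_sum_rarest {F : ℝ → Fin (n + 2) → ℝ} {L : Fin (n + 2) → ℝ}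
    (h : ∀ i, i ≠ 0 → Tendsto (fun γ => F γ i) (𝓝[>] 0) (𝓝 (L i))) :
    Tendsto (fun γ => ∑ i ∈ Finset.univ.erase 0, γ ^ (b.αmax - b.α i) * F γ i) (𝓝[>] 0)
      (𝓝 (∑ i ∈ b.rarest, L i)) := by
  rw [sum_rarest_eq]
  exact tendsto_finsetSum _ fun i hi =>
    (tendsto_rpow_αmax_sub i).mul (h i (Finset.ne_of_mem_erase hi))

lemma levelWeights_zero (γ e : ℝ) : b.levelWeights γ e 0 = 1 / b.totalWeight γ e := by
  rw [levelWeights, if_pos rfl]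

lemma levelWeights_of_ne {i : Fin (n + 2)} (hi : i ≠ 0) (γ e : ℝ) :
    b.levelWeights γ e i = b.rarity γ i * b.weight i e / b.totalWeight γ e := by
  rw [levelWeights, if_neg hi]

section Limits

variable (hbest : ∀ i, i ≠ 0 → (b.arm i).mean < (b.arm 0).mean)
  (hsecond : ∀ i, i ≠ 0 → i ≠ 1 → (b.arm i).mean < (b.arm 1).mean)
  {e : ℝ → ℝ} (he : ∀ γ, 0 < γ → e γ ∈ Set.Ioo 0 b.topLevel)
  (hsum : ∀ γ, 0 < γ → ∑ i ∈ Finset.univ.erase 0, b.rarity γ i * b.ratio i (e γ) = 1)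
include hbest hsecond he

/-! ### The best arm is not the rarest -/

section NotRarest

variable (hα : b.αmax ≠ b.α 0)
include hsum hα

omit he hsum hbest hsecond in
lemma rarest_nonempty : b.rarest.Nonempty := by
  obtain ⟨k, -, hk⟩ := Finset.exists_mem_eq_sup' Finset.univ_nonempty b.α
  exact ⟨k, mem_rarest.2 ⟨fun h => hα (h ▸ hk), hk.symm⟩⟩

/-- The level tends to zero, since the ratio of a rarest arm enters the balance condition with a
factor tending to infinity. -/
lemma tendsto_level_zero : Tendsto e (𝓝[>] 0) (𝓝[>] 0) := by
  obtain ⟨k, hk⟩ := rarest_nonempty hα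
  obtain ⟨hk0, hk⟩ := mem_rarest.1 hk
  have hpos : 0 < b.αmax - b.α 0 := sub_pos.2 (lt_of_le_of_ne (α_le_αmax 0) hα.symm)
  have hmax := maxLevel_pos (hbest k hk0)
  have hmem : ∀ γ, 0 < γ → ∀ i, i ≠ 0 → e γ ∈ Set.Ico 0 (maxLevel (b.arm 0) (b.arm i)) :=
    fun γ hγ i hi => Ico_subset hbest hsecond hi (Set.Ioo_subset_Ico_self (he γ hγ))
  refine tendsto_nhdsWithin_iff.2 ⟨?_, ?_⟩
  · refine (strictMonoOn_ratioAt (hbest k hk0)).tendsto_of_tendsto_comp Set.ordConnected_Ico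
      (Set.left_mem_Ico.2 hmax) ?_ ?_
    · filter_upwards [self_mem_nhdsWithin] with γ hγ
      exact hmem γ hγ k hk0
    · rw [ratioAt_zero (hbest k hk0)]
      refine tendsto_of_tendsto_of_tendsto_of_le_of_le' tendsto_const_nhds
        (tendsto_rpow_zero hpos) ?_ ?_
      · filter_upwards [self_mem_nhdsWithin] with γ hγ
        exact ratioAt_nonneg (hbest k hk0) (hmem γ hγ k hk0)
      · filter_upwards [self_mem_nhdsWithin] with γ hγ
        have hγ' : 0 < γ := hγ
        have h1 : b.rarity γ k * b.ratio k (e γ) ≤ 1 := by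
          rw [← hsum γ hγ]
          refine Finset.single_le_sum (f := fun i => b.rarity γ i * b.ratio i (e γ))
            (fun i hi => ?_) (by simpa using hk0)
          have hi0 := Finset.ne_of_mem_erase hi
          exact mul_nonneg (rarity_pos hγ i).le (ratioAt_nonneg (hbest i hi0) (hmem γ hγ i hi0))
        have h2 : γ ^ (b.αmax - b.α 0) * b.rarity γ k = 1 := by
          rw [rarity, hk, ← Real.rpow_add hγ']
          simp
        have h3 : b.ratio k (e γ) =
            γ ^ (b.αmax - b.α 0) * (b.rarity γ k * b.ratio k (e γ)) := by
          rw [← mul_assoc, h2, one_mul]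
        change b.ratio k (e γ) ≤ _
        rw [h3]
        exact mul_le_of_le_one_right (Real.rpow_nonneg hγ'.le _) h1
  · filter_upwards [self_mem_nhdsWithin] with γ hγ
    exact (he γ hγ).1

/-- The balance condition determines the order of the level: its square is proportional to
`γ ^ (αmax - α 0)`. -/
lemma tendsto_rpow_div_sq : Tendsto (fun γ => γ ^ (b.αmax - b.α 0) / e γ ^ 2) (𝓝[>] 0)
    (𝓝 (∑ k ∈ b.rarest, (b.arm 0).secondMoment / 2 * raise (b.arm 0) (b.arm k) 0 ^ 2 /
      highDiv (b.arm 0) (b.arm k) 0 ^ 3)) := by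
  refine (tendsto_sum_rarest (F := fun γ i => b.ratio i (e γ) / e γ ^ 2) fun i hi =>
    (tendsto_ratioAt_div_sq (hbest i hi)).comp
      (tendsto_level_zero hbest hsecond he hsum hα)).congr' ?_
  filter_upwards [self_mem_nhdsWithin] with γ hγ
  have hγ' : 0 < γ := hγ
  rw [← mul_one (γ ^ (b.αmax - b.α 0)), ← hsum γ hγ, Finset.mul_sum, Finset.sum_div]
  refine Finset.sum_congr rfl fun i _ => ?_
  rw [rarity, ← mul_assoc, ← Real.rpow_add hγ', sub_add_sub_cancel, mul_div_assoc]

lemma tendsto_totalWeight_div : Tendsto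
    (fun γ => γ ^ (b.αmax - b.α 0) * b.totalWeight γ (e γ) / e γ) (𝓝[>] 0)
    (𝓝 (∑ k ∈ b.rarest, 1 / highDiv (b.arm 0) (b.arm k) 0)) := by
  have he0 := tendsto_level_zero hbest hsecond he hsum hα
  have h1 := (tendsto_rpow_div_sq hbest hsecond he hsum hα).mul
    (he0.mono_right nhdsWithin_le_nhds)
  have h2 := tendsto_sum_rarest (b := b) (F := fun γ i => b.weight i (e γ) / e γ) fun i hi =>
    (tendsto_weightAt_div (hbest i hi)).comp he0
  have h3 := h1.add h2
  rw [mul_zero, zero_add] at h3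
  refine h3.congr' ?_
  filter_upwards [self_mem_nhdsWithin] with γ hγ
  have hγ' : 0 < γ := hγ
  have hpos := (he γ hγ).1.ne'
  rw [totalWeight, mul_add, mul_one, add_div, Finset.mul_sum, Finset.sum_div]
  congr 1
  · field_simp
  · refine Finset.sum_congr rfl fun i _ => ?_
    rw [rarity, ← mul_assoc, ← Real.rpow_add hγ', sub_add_sub_cancel, mul_div_assoc]

/-- The weights in the case in which the level tends to zero. -/
theorem hasOrder_of_not_rarest {w : ℝ → Fin (n + 2) → ℝ}
    (hw : ∀ᶠ γ in 𝓝[>] (0 : ℝ), w γ = b.levelWeights γ (e γ)) {A : Fin (n + 2) → ℝ}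
    (hA : b.IsTopTilt A) :
    HasOrder (fun γ => w γ 0) ((b.αmax - b.α 0) / 2) (b.limBest A) ∧
      ∀ i, i ≠ 0 → HasOrder (fun γ => w γ i) (b.αmax - b.α i) (b.limOther A i) := by
  have hAi : ∀ i, i ≠ 0 → A i = raise (b.arm 0) (b.arm i) 0 := fun i hi => by
    rw [(hA.2 i hi).eq_tilt, raise, meanLow_zero]
    rfl
  have hDi : ∀ i, i ≠ 0 → b.divHigh i (A i) (b.mean 0) = highDiv (b.arm 0) (b.arm i) 0 :=
    fun i hi => by
      rw [hAi i hi, highDiv, meanLow_zero]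
      rfl
  have h0mem : ∀ i, i ≠ 0 → (0 : ℝ) ∈ Set.Ico 0 (maxLower (b.arm 0) (b.arm i)) := fun i hi =>
    Set.left_mem_Ico.2 (maxLower_pos (hbest i hi))
  have hDpos : ∀ i, i ≠ 0 → 0 < highDiv (b.arm 0) (b.arm i) 0 := fun i hi =>
    highDiv_pos (hbest i hi) (h0mem i hi)
  have hRpos : ∀ i, i ≠ 0 → 0 < raise (b.arm 0) (b.arm i) 0 := fun i hi =>
    raise_pos (hbest i hi) (h0mem i hi)
  have hne := rarest_nonempty hα
  set S := ∑ k ∈ b.rarest, 1 / highDiv (b.arm 0) (b.arm k) 0 with hS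
  have hSpos : 0 < S := Finset.sum_pos
    (fun k hk => one_div_pos.2 (hDpos k (mem_rarest.1 hk).1)) hne
  have hS' : ∑ k ∈ b.rarest, 1 / b.divHigh k (A k) (b.mean 0) = S :=
    Finset.sum_congr rfl fun k hk => by rw [hDi k (mem_rarest.1 hk).1]
  have hLi : ∀ i, i ≠ 0 → b.limOther A i = 1 / highDiv (b.arm 0) (b.arm i) 0 / S := fun i hi => by
    rw [limOther, hS', hDi i hi]
  have hk := tendsto_rpow_div_sq hbest hsecond he hsum hα
  set κ := ∑ k ∈ b.rarest, (b.arm 0).secondMoment / 2 * raise (b.arm 0) (b.arm k) 0 ^ 2 /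
      highDiv (b.arm 0) (b.arm k) 0 ^ 3 with hκ
  have hκpos : 0 < κ := Finset.sum_pos (fun k hk => by
    have h1 := hDpos k (mem_rarest.1 hk).1
    have h2 := hRpos k (mem_rarest.1 hk).1
    have h3 := (b.arm 0).secondMoment_pos
    positivity) hne
  have hbest' : b.limBest A = √κ / S := by
    rw [limBest]
    have h1 : (b.arm 0).secondMoment / 2 *
        ∑ k ∈ b.rarest, A k ^ 2 * b.limOther A k ^ 2 / b.divHigh k (A k) (b.mean 0) =
        κ / S ^ 2 := by
      rw [hκ, Finset.mul_sum, Finset.sum_div]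
      refine Finset.sum_congr rfl fun k hk => ?_
      have hk0 := (mem_rarest.1 hk).1
      have h1 := (hDpos k hk0).ne'
      rw [hLi k hk0, hDi k hk0, hAi k hk0]
      field_simp
    rw [h1, Real.sqrt_div hκpos.le, Real.sqrt_sq hSpos.le]
  have hZ := tendsto_totalWeight_div hbest hsecond he hsum hα
  constructor
  · refine HasScaledLimit.hasOrder ?_ ?_
    · rw [hbest']
      refine ((hk.sqrt).div hZ hSpos.ne').congr' ?_
      filter_upwards [self_mem_nhdsWithin, hw] with γ hγ hwγ
      have hγ' : 0 < γ := hγ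
      have hpos := (he γ hγ).1
      have hT := (totalWeight_pos hbest hsecond hγ (he γ hγ)).ne'
      have hhalf : γ ^ (b.αmax - b.α 0) =
          γ ^ ((b.αmax - b.α 0) / 2) * γ ^ ((b.αmax - b.α 0) / 2) := by
        rw [← Real.rpow_add hγ', add_halves]
      have hg := Real.rpow_pos_of_pos hγ' ((b.αmax - b.α 0) / 2)
      rw [hwγ, levelWeights_zero]
      simp only [Pi.div_apply]
      rw [Real.sqrt_div' _ (sq_nonneg _), Real.sqrt_sq hpos.le, hhalf, Real.sqrt_mul_self hg.le]
      have := hg.ne'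
      field_simp
    · rw [hbest']
      exact (div_pos (Real.sqrt_pos.2 hκpos) hSpos).ne'
  · intro i hi
    refine HasScaledLimit.hasOrder ?_ ?_
    · rw [hLi i hi]
      refine (((tendsto_weightAt_div (hbest i hi)).comp
        (tendsto_level_zero hbest hsecond he hsum hα)).div hZ hSpos.ne').congr' ?_
      filter_upwards [self_mem_nhdsWithin, hw] with γ hγ hwγ
      have hγ' : 0 < γ := hγ
      have hpos := (he γ hγ).1.ne'
      have hT := (totalWeight_pos hbest hsecond hγ (he γ hγ)).ne'
      have hr : γ ^ (b.αmax - b.α i) = γ ^ (b.αmax - b.α 0) * b.rarity γ i := by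
        rw [rarity, ← Real.rpow_add hγ', sub_add_sub_cancel]
      have hg := (Real.rpow_pos_of_pos hγ' (b.αmax - b.α 0)).ne'
      have hq := (rarity_pos (b := b) hγ' i).ne'
      rw [hwγ, levelWeights_of_ne hi, hr]
      simp only [Pi.div_apply, Function.comp]
      change b.weight i (e γ) / e γ / _ = _
      field_simp
    · rw [hLi i hi]
      exact (div_pos (one_div_pos.2 (hDpos i hi)) hSpos).ne'

end NotRarest

/-! ### The best arm is among the rarest -/

section Rarest

variable (hα : b.α 0 = b.αmax)
include hα

omit hbest hsecond he in
lemma rarity_eq (γ : ℝ) (i : Fin (n + 2)) : b.rarity γ i = γ ^ (b.αmax - b.α i) := by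
  rw [rarity, hα]

omit hbest hsecond he in
lemma tendsto_sum_rarity {F : ℝ → Fin (n + 2) → ℝ} {L : Fin (n + 2) → ℝ}
    (h : ∀ i, i ≠ 0 → Tendsto (fun γ => F γ i) (𝓝[>] 0) (𝓝 (L i))) :
    Tendsto (fun γ => ∑ i ∈ Finset.univ.erase 0, b.rarity γ i * F γ i) (𝓝[>] 0)
      (𝓝 (∑ i ∈ b.rarest, L i)) := by
  simp_rw [rarity_eq hα]
  exact tendsto_sum_rarest h

/-- If the ratios of the rarest arms at a smaller level sum up to less than one, then the level of
the optimal weights is eventually larger. -/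
lemma eventually_lt_level (hsum : ∀ γ, 0 < γ →
      ∑ i ∈ Finset.univ.erase 0, b.rarity γ i * b.ratio i (e γ) = 1) {e' : ℝ}
    (he' : e' ∈ Set.Ico 0 b.topLevel) (h : ∑ i ∈ b.rarest, b.ratio i e' < 1) :
    ∀ᶠ γ in 𝓝[>] (0 : ℝ), e' < e γ := by
  have hlim := tendsto_sum_rarity hα (F := fun _ i => b.ratio i e') (L := fun i => b.ratio i e')
    fun i _ => tendsto_const_nhds
  filter_upwards [self_mem_nhdsWithin, hlim.eventually (eventually_lt_nhds h)] with γ hγ hlt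
  rw [← hsum γ hγ] at hlt
  exact ((strictMonoOn_sum_ratio hbest hsecond (fun i _ => (rarity_pos hγ i).le)
    ⟨1, by simp, rarity_pos hγ 1⟩).lt_iff_lt he' (Set.Ioo_subset_Ico_self (he γ hγ))).1 hlt

/-- If the ratios of the rarest arms at a larger level sum up to more than one, then the level of
the optimal weights is eventually smaller. -/
lemma eventually_level_lt (hsum : ∀ γ, 0 < γ →
      ∑ i ∈ Finset.univ.erase 0, b.rarity γ i * b.ratio i (e γ) = 1) {e' : ℝ}
    (he' : e' ∈ Set.Ico 0 b.topLevel) (h : 1 < ∑ i ∈ b.rarest, b.ratio i e') :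
    ∀ᶠ γ in 𝓝[>] (0 : ℝ), e γ < e' := by
  have hlim := tendsto_sum_rarity hα (F := fun _ i => b.ratio i e') (L := fun i => b.ratio i e')
    fun i _ => tendsto_const_nhds
  filter_upwards [self_mem_nhdsWithin, hlim.eventually (eventually_gt_nhds h)] with γ hγ hlt
  rw [← hsum γ hγ] at hlt
  exact ((strictMonoOn_sum_ratio hbest hsecond (fun i _ => (rarity_pos hγ i).le)
    ⟨1, by simp, rarity_pos hγ 1⟩).lt_iff_lt (Set.Ioo_subset_Ico_self (he γ hγ)) he').1 hlt

omit hbest hsecond he in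
/-- The limit of a weight follows from the limits of its relative weight and of the total. -/
lemma hasScaledLimit_of_tendsto {w : ℝ → Fin (n + 2) → ℝ}
    (hw : ∀ᶠ γ in 𝓝[>] (0 : ℝ), w γ = b.levelWeights γ (e γ)) {S : ℝ} (hS : S ≠ 0)
    (hT : Tendsto (fun γ => b.totalWeight γ (e γ)) (𝓝[>] 0) (𝓝 S)) {i : Fin (n + 2)} {W : ℝ}
    (hW : i ≠ 0 → Tendsto (fun γ => b.weight i (e γ)) (𝓝[>] 0) (𝓝 W)) :
    HasScaledLimit (fun γ => w γ i) (b.αmax - b.α i) ((if i = 0 then 1 else W) / S) := by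
  split_ifs with hi
  · subst hi
    refine (tendsto_const_nhds.div hT hS).congr' ?_
    filter_upwards [hw] with γ hwγ
    simp [hwγ, levelWeights_zero, hα]
  · refine ((hW hi).div hT hS).congr' ?_
    filter_upwards [hw, self_mem_nhdsWithin] with γ hwγ hγ
    have hγ' : 0 < γ := hγ
    have := (Real.rpow_pos_of_pos hγ' (b.αmax - b.α i)).ne'
    rw [hwγ, levelWeights_of_ne hi, rarity_eq hα]
    simp only [Pi.div_apply]
    field_simp

/-- If the balance condition of the rarest arms alone has a solution below the largest level, then
the level of the optimal weights converges to it. -/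
theorem hasOrder_of_balanced (hsum : ∀ γ, 0 < γ →
      ∑ i ∈ Finset.univ.erase 0, b.rarity γ i * b.ratio i (e γ) = 1)
    {w : ℝ → Fin (n + 2) → ℝ} (hw : ∀ᶠ γ in 𝓝[>] (0 : ℝ), w γ = b.levelWeights γ (e γ))
    {c : ℝ} (hc : c ∈ Set.Ioo 0 b.topLevel) (hbal : ∑ i ∈ b.rarest, b.ratio i c = 1)
    (i : Fin (n + 2)) :
    HasOrder (fun γ => w γ i) (b.αmax - b.α i) (b.limProfile (b.profileAt c) i) := by
  have hne : b.rarest.Nonempty := by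
    by_contra hemp
    rw [Finset.not_nonempty_iff_eq_empty.1 hemp, Finset.sum_empty] at hbal
    exact zero_ne_one hbal
  have hmono := strictMonoOn_sum_rarest hbest hsecond hne
  have hc' := Set.Ioo_subset_Ico_self hc
  have hlim : Tendsto e (𝓝[>] 0) (𝓝 c) := by
    refine tendsto_order.2 ⟨fun a ha => ?_, fun a ha => ?_⟩
    · rcases lt_or_ge a 0 with h0 | h0
      · filter_upwards [self_mem_nhdsWithin] with γ hγ
        exact h0.trans (he γ hγ).1
      · have ha' : a ∈ Set.Ico 0 b.topLevel := ⟨h0, ha.trans hc.2⟩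
        exact eventually_lt_level hbest hsecond he hα hsum ha' (hbal ▸ hmono ha' hc' ha)
    · rcases lt_or_ge a b.topLevel with h0 | h0
      · have ha' : a ∈ Set.Ico 0 b.topLevel := ⟨hc.1.le.trans ha.le, h0⟩
        exact eventually_level_lt hbest hsecond he hα hsum ha' (hbal ▸ hmono hc' ha' ha)
      · filter_upwards [self_mem_nhdsWithin] with γ hγ
        exact (he γ hγ).2.trans_le h0
  have hW : ∀ i, i ≠ 0 → Tendsto (fun γ => b.weight i (e γ)) (𝓝[>] 0) (𝓝 (b.weight i c)) := by
    intro i hi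
    have hcont : ContinuousAt (b.weight i) c := (continuousOn_weightAt (hbest i hi)).continuousAt
      (Ico_mem_nhds hc.1 (hc.2.trans_le (topLevel_le hbest hsecond hi)))
    exact hcont.tendsto.comp hlim
  have hSpos : 0 < 1 + ∑ k ∈ b.rarest, b.weight k c :=
    add_pos_of_pos_of_nonneg one_pos (Finset.sum_nonneg fun k hk =>
      (weight_pos hbest hsecond (mem_rarest.1 hk).1 hc).le)
  rw [limProfile_profileAt]
  refine (hasScaledLimit_of_tendsto hα hw hSpos.ne'
    (tendsto_const_nhds.add (tendsto_sum_rarity hα hW)) (hW i)).hasOrder ?_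
  refine (div_pos ?_ hSpos).ne'
  split_ifs with hi
  · exact one_pos
  · exact weight_pos hbest hsecond hi hc

omit hα he in
lemma ratio_mono_topLevel {i : Fin (n + 2)} (hi : i ≠ 0) (hi1 : i ≠ 1) {e' : ℝ}
    (he' : e' ∈ Set.Ico 0 b.topLevel) : b.ratio i e' < b.ratio i b.topLevel :=
  strictMonoOn_ratioAt (hbest i hi) (Ico_subset hbest hsecond hi he')
    ⟨(maxLevel_pos (hbest 1 (by simp))).le, topLevel_lt hbest hsecond hi hi1⟩ he'.2

/-- If the ratios of the rarest arms at the largest level sum up to at most one, and the second best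
arm is not among them, then the level of the optimal weights converges to the largest level. -/
lemma tendsto_level_topLevel (hsum : ∀ γ, 0 < γ →
      ∑ i ∈ Finset.univ.erase 0, b.rarity γ i * b.ratio i (e γ) = 1) (h1 : 1 ∉ b.rarest)
    (hζ : ∑ i ∈ b.rarest, b.ratio i b.topLevel ≤ 1) :
    Tendsto e (𝓝[>] 0) (𝓝[<] b.topLevel) := by
  refine tendsto_nhdsWithin_iff.2 ⟨tendsto_order.2 ⟨fun a ha => ?_, fun a ha => ?_⟩, ?_⟩
  · rcases lt_or_ge a 0 with h0 | h0
    · filter_upwards [self_mem_nhdsWithin] with γ hγ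
      exact h0.trans (he γ hγ).1
    · refine eventually_lt_level hbest hsecond he hα hsum ⟨h0, ha⟩ ?_
      rcases b.rarest.eq_empty_or_nonempty with hemp | hne
      · rw [hemp, Finset.sum_empty]
        exact one_pos
      · refine lt_of_lt_of_le (Finset.sum_lt_sum_of_nonempty hne fun i hi => ?_) hζ
        exact ratio_mono_topLevel hbest hsecond (mem_rarest.1 hi).1
          (fun h => h1 (h ▸ hi)) ⟨h0, ha⟩
  · filter_upwards [self_mem_nhdsWithin] with γ hγ
    exact (he γ hγ).2.trans ha
  · filter_upwards [self_mem_nhdsWithin] with γ hγ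
    exact (he γ hγ).2

omit hα he hbest hsecond in
/-- The term of the second best arm, separated from the others. -/
lemma sum_erase_zero_eq (c F : Fin (n + 2) → ℝ) : ∑ i ∈ Finset.univ.erase 0, c i * F i =
    ∑ i ∈ Finset.univ.erase 0, c i * (if i = 1 then 0 else F i) + c 1 * F 1 := by
  have hmem : (1 : Fin (n + 2)) ∈ Finset.univ.erase 0 := by simp
  rw [← Finset.add_sum_erase _ _ hmem, ← Finset.add_sum_erase _ (fun i => c i * ite _ _ _) hmem,
    if_pos rfl, mul_zero, zero_add, add_comm]
  congr 1
  exact Finset.sum_congr rfl fun i hi => by rw [if_neg (Finset.ne_of_mem_erase hi)]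

omit hα he hbest hsecond in
lemma sum_rarest_ite (h1 : 1 ∉ b.rarest) (F : Fin (n + 2) → ℝ) :
    ∑ i ∈ b.rarest, (if i = 1 then 0 else F i) = ∑ i ∈ b.rarest, F i :=
  Finset.sum_congr rfl fun i hi => if_neg fun (h : i = 1) => h1 (h ▸ hi)

/-- The weights in the case in which the level converges to the largest level.  The second best arm
then makes up for the part `1 - ζ` of the balance condition. -/
theorem hasScaledLimit_of_ratioSum_le (hsum : ∀ γ, 0 < γ →
      ∑ i ∈ Finset.univ.erase 0, b.rarity γ i * b.ratio i (e γ) = 1)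
    {w : ℝ → Fin (n + 2) → ℝ} (hw : ∀ᶠ γ in 𝓝[>] (0 : ℝ), w γ = b.levelWeights γ (e γ))
    (h1 : b.α 1 < b.αmax) (hζ : b.ζ (b.profileAt b.topLevel) ≤ 1) :
    (∀ i, i ≠ 1 → HasOrder (fun γ => w γ i) (b.αmax - b.α i)
      (b.limProfile (b.profileAt b.topLevel) i)) ∧
    HasScaledLimit (fun γ => w γ 1) ((b.αmax - b.α 1) / 2)
      (b.limSecond (b.profileAt b.topLevel)) ∧
    (b.ζ (b.profileAt b.topLevel) < 1 → HasOrder (fun γ => w γ 1) ((b.αmax - b.α 1) / 2)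
      (b.limSecond (b.profileAt b.topLevel))) := by
  have hb1 := hbest 1 (by simp)
  have h1' : 1 ∉ b.rarest := fun h => h1.ne (mem_rarest.1 h).2
  have hζeq : b.ζ (b.profileAt b.topLevel) = ∑ i ∈ b.rarest, b.ratio i b.topLevel :=
    ratioSum_profileAt _
  set E := b.topLevel with hE
  have hEpos : 0 < E := maxLevel_pos hb1
  have hlim := tendsto_level_topLevel hbest hsecond he hα hsum h1' (hζeq ▸ hζ)
  have hlim' : Tendsto e (𝓝[>] 0) (𝓝 E) := hlim.mono_right nhdsWithin_le_nhds
  have hmemE : ∀ i, i ≠ 0 → i ≠ 1 → E ∈ Set.Ioo 0 (maxLevel (b.arm 0) (b.arm i)) :=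
    fun i hi hi1 => ⟨hEpos, topLevel_lt hbest hsecond hi hi1⟩
  have hratio : ∀ i, i ≠ 0 → i ≠ 1 →
      Tendsto (fun γ => b.ratio i (e γ)) (𝓝[>] 0) (𝓝 (b.ratio i E)) := fun i hi hi1 => by
    have hcont : ContinuousAt (b.ratio i) E := (continuousOn_ratioAt (hbest i hi)).continuousAt
      (Ico_mem_nhds (hmemE i hi hi1).1 (hmemE i hi hi1).2)
    exact hcont.tendsto.comp hlim'
  have hweight : ∀ i, i ≠ 0 → i ≠ 1 →
      Tendsto (fun γ => b.weight i (e γ)) (𝓝[>] 0) (𝓝 (b.weight i E)) := fun i hi hi1 => by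
    have hcont : ContinuousAt (b.weight i) E := (continuousOn_weightAt (hbest i hi)).continuousAt
      (Ico_mem_nhds (hmemE i hi hi1).1 (hmemE i hi hi1).2)
    exact hcont.tendsto.comp hlim'
  have hwpos : ∀ i, i ≠ 0 → i ≠ 1 → 0 < b.weight i E := fun i hi hi1 =>
    weightAt_pos (hbest i hi) (hmemE i hi hi1)
  set S := 1 + ∑ k ∈ b.rarest, b.weight k E with hS
  have hSpos : 0 < S := add_pos_of_pos_of_nonneg one_pos (Finset.sum_nonneg fun k hk =>
    (hwpos k (mem_rarest.1 hk).1 fun h => h1' (h ▸ hk)).le)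
  set z := b.ζ (b.profileAt E) with hz
  -- The second best arm takes the remaining part of the balance condition.
  have hc1 : Tendsto (fun γ => b.rarity γ 1 * b.ratio 1 (e γ)) (𝓝[>] 0) (𝓝 (1 - z)) := by
    have h2 := tendsto_sum_rarity hα (F := fun γ i => if i = 1 then 0 else b.ratio i (e γ))
      (L := fun i => if i = 1 then 0 else b.ratio i E) fun i hi => by
        split_ifs with hi1
        · exact tendsto_const_nhds
        · exact hratio i hi hi1
    rw [sum_rarest_ite h1', ← hζeq] at h2
    refine (h2.const_sub 1).congr' ?_
    filter_upwards [self_mem_nhdsWithin] with γ hγ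
    rw [← hsum γ hγ, sum_erase_zero_eq]
    ring
  -- Its parameter `r` therefore vanishes like the square root of its rarity.
  have hhalf : ∀ γ : ℝ, 0 < γ → b.rarity γ 1 =
      γ ^ ((b.αmax - b.α 1) / 2) * γ ^ ((b.αmax - b.α 1) / 2) := fun γ hγ => by
    rw [rarity_eq hα, ← Real.rpow_add hγ, add_halves]
  have hs := (b.arm 1).secondMoment_pos
  have hsq : Tendsto (fun γ => γ ^ ((b.αmax - b.α 1) / 2) * b.weight 1 (e γ)) (𝓝[>] 0)
      (𝓝 (maxLower (b.arm 0) (b.arm 1) * √((1 - z) * (b.arm 1).secondMoment / (2 * E)))) := by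
    have hr := (tendsto_ratioAt_mul_sq hb1).comp hlim
    have hy : Tendsto (fun γ => lower (b.arm 0) (b.arm 1) (e γ)) (𝓝[>] 0)
        (𝓝 (maxLower (b.arm 0) (b.arm 1))) :=
      ((tendsto_lower_maxLevel hb1).mono_right nhdsWithin_le_nhds).comp hlim
    have hne : 2 * maxLevel (b.arm 0) (b.arm 1) / (b.arm 1).secondMoment ≠ 0 :=
      (div_pos (mul_pos two_pos (maxLevel_pos hb1)) hs).ne'
    have h2 := hy.mul (hc1.div hr hne).sqrt
    rw [div_div_eq_mul_div] at h2
    refine h2.congr' ?_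
    filter_upwards [self_mem_nhdsWithin] with γ hγ
    have hγ' : 0 < γ := hγ
    have heγ := he γ hγ
    have hrpos := raise_pos hb1 (lower_mem_Ico hb1 (Set.Ioo_subset_Ico_self heγ))
    have hratiopos : 0 < b.ratio 1 (e γ) := by
      have := strictMonoOn_ratioAt hb1 (Set.left_mem_Ico.2 (maxLevel_pos hb1))
        (Set.Ioo_subset_Ico_self heγ) heγ.1
      rwa [ratioAt_zero hb1] at this
    have hg := Real.rpow_pos_of_pos hγ' ((b.αmax - b.α 1) / 2)
    have h3 : b.rarity γ 1 * b.ratio 1 (e γ) / (ratioAt (b.arm 0) (b.arm 1) (e γ) *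
        raise (b.arm 0) (b.arm 1) (lower (b.arm 0) (b.arm 1) (e γ)) ^ 2) =
        (γ ^ ((b.αmax - b.α 1) / 2) /
          raise (b.arm 0) (b.arm 1) (lower (b.arm 0) (b.arm 1) (e γ))) ^ 2 := by
      have h4 : ratioAt (b.arm 0) (b.arm 1) (e γ) = b.ratio 1 (e γ) := rfl
      rw [h4, hhalf γ hγ', div_pow, mul_comm (b.ratio 1 (e γ)),
        mul_div_mul_right _ _ hratiopos.ne', sq, sq]
    simp only [Function.comp, Pi.div_apply]
    rw [h3, Real.sqrt_sq (div_pos hg hrpos).le, weight, weightAt]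
    ring
  have hg0 := tendsto_rpow_zero (half_pos (sub_pos.2 h1))
  have hT : Tendsto (fun γ => b.totalWeight γ (e γ)) (𝓝[>] 0) (𝓝 S) := by
    have h2 := tendsto_sum_rarity hα (F := fun γ i => if i = 1 then 0 else b.weight i (e γ))
      (L := fun i => if i = 1 then 0 else b.weight i E) fun i hi => by
        split_ifs with hi1
        · exact tendsto_const_nhds
        · exact hweight i hi hi1
    rw [sum_rarest_ite h1'] at h2
    have h3 := (h2.add (hg0.mul hsq)).const_add 1
    rw [zero_mul, add_zero] at h3
    refine h3.congr' ?_
    filter_upwards [self_mem_nhdsWithin] with γ hγ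
    have h4 := sum_erase_zero_eq (b.rarity γ) fun i => b.weight i (e γ)
    rw [totalWeight]
    linear_combination -h4 - b.weight 1 (e γ) * hhalf γ hγ
  have hsecondLim : b.limSecond (b.profileAt E) =
      maxLower (b.arm 0) (b.arm 1) * √((1 - z) * (b.arm 1).secondMoment / (2 * E)) / S := by
    have h2 : (b.profileAt E 1).2 = maxLower (b.arm 0) (b.arm 1) := by
      rw [profileAt_of_ne (by simp)]
      exact lower_maxLevel hb1
    have h3 : b.f 1 0 (maxLower (b.arm 0) (b.arm 1)) = E := by
      have := f_eq_level hbest (i := 1) (by simp)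
        (Set.right_mem_Icc.2 (maxLower_pos hb1).le)
      rwa [raise_maxLower hb1, level_maxLower hb1] at this
    rw [limSecond, h2, h3]
    congr 2
    refine Finset.sum_congr rfl fun k hk => ?_
    rw [profileAt_of_ne (mem_rarest.1 hk).1]
    rfl
  have hlimSecond : HasScaledLimit (fun γ => w γ 1) ((b.αmax - b.α 1) / 2)
      (b.limSecond (b.profileAt E)) := by
    rw [hsecondLim]
    refine (hsq.div hT hSpos.ne').congr' ?_
    filter_upwards [self_mem_nhdsWithin, hw] with γ hγ hwγ
    have hg := (Real.rpow_pos_of_pos hγ ((b.αmax - b.α 1) / 2)).ne'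
    rw [hwγ, levelWeights_of_ne (by simp), hhalf γ hγ]
    simp only [Pi.div_apply]
    field_simp
  refine ⟨fun i hi1 => ?_, hlimSecond, fun hlt => hlimSecond.hasOrder ?_⟩
  · rw [limProfile_profileAt]
    refine (hasScaledLimit_of_tendsto hα hw hSpos.ne' hT fun hi => hweight i hi hi1).hasOrder ?_
    refine (div_pos ?_ hSpos).ne'
    split_ifs with hi
    · exact one_pos
    · exact hwpos i hi hi1
  · rw [hsecondLim]
    have := maxLower_pos hb1
    have := sub_pos.2 hlt
    positivity

omit he in
/-- If the sum of the ratios of the rarest arms exceeds one at some level below the largest one,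
then there is exactly one balanced profile, and the optimal weights converge accordingly. -/
theorem balanced_case (hxi : b.ratioSum (b.profileAt b.topLevel) ≠ 1) {e' : ℝ}
    (he' : e' ∈ Set.Ico 0 b.topLevel) (h : 1 ≤ ∑ i ∈ b.rarest, b.ratio i e') :
    (∃! q, b.IsBalanced q) ∧ ∀ q, b.IsBalanced q →
      ∀ w : ℝ → Fin (n + 2) → ℝ, b.IsOptimalFamily w →
      ∀ i, HasOrder (fun γ => w γ i) (b.αmax - b.α i) (b.limProfile q i) := by
  rw [sum_rarest_eq] at h
  obtain ⟨c, hc, hbal⟩ := exists_sum_ratio_eq_one hbest hsecond he' h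
  rw [← sum_rarest_eq] at hbal
  have hiff := isBalanced_iff hbest hsecond hxi hc hbal
  refine ⟨⟨b.profileAt c, (hiff _).2 rfl, fun q hq => (hiff q).1 hq⟩, fun q hq w hw i => ?_⟩
  choose! e he hsum using fun γ (hγ : 0 < γ) => exists_level hbest hsecond hγ
  rw [(hiff q).1 hq]
  refine hasOrder_of_balanced hbest hsecond he hα hsum ?_ hc hbal i
  filter_upwards [hw, self_mem_nhdsWithin] with γ hwγ hγ
  exact (isOptimal_iff hbest hsecond hγ (he γ hγ) (hsum γ hγ) _).1 hwγ

end Rarest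

end Limits

end RareBandit

/-! ### The asymptotics of the optimal weights -/

theorem theorem2 {n : ℕ} (b : RareBandit n)
    (hbest : ∀ i, i ≠ 0 → b.mean i < b.mean 0)
    (hsecond : ∀ i, i ≠ 0 → i ≠ 1 → b.mean i < b.mean 1) :
    -- optimal weights exist
    (∀ γ : ℝ, 0 < γ → ∃ w, b.IsOptimal γ w) ∧
    -- the parameters in the limits and in `ζ` are well defined
    (∃! A, b.IsTopTilt A) ∧ (∃! ξ, b.IsXiZero ξ) ∧
    -- Case 1: the best arm is not the rarest
    (b.αmax ≠ b.α 0 → ∀ A, b.IsTopTilt A → ∀ w, b.IsOptimalFamily w →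
      RareBandit.HasOrder (fun γ => w γ 0) ((b.αmax - b.α 0) / 2) (b.limBest A) ∧
      ∀ i, i ≠ 0 → RareBandit.HasOrder (fun γ => w γ i) (b.αmax - b.α i) (b.limOther A i)) ∧
    -- Case 2: the best arm is uniquely the rarest
    (b.α 0 = b.αmax → (∀ i, i ≠ 0 → b.α i < b.αmax) →
      ∀ ξ, b.IsXiZero ξ → ∀ w, b.IsOptimalFamily w →
      RareBandit.HasOrder (fun γ => w γ 1) ((b.αmax - b.α 1) / 2) (b.limSecond ξ) ∧
      ∀ i, i ≠ 1 → RareBandit.HasOrder (fun γ => w γ i) (b.αmax - b.α i) (b.limProfile ξ i)) ∧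
    -- Case 3: the best and the second best arm only are the rarest
    (b.α 0 = b.αmax → b.α 1 = b.αmax → (∀ i, i ≠ 0 → i ≠ 1 → b.α i < b.αmax) →
      (∃! q, b.IsBalanced q) ∧ ∀ q, b.IsBalanced q → ∀ w, b.IsOptimalFamily w →
      ∀ i, RareBandit.HasOrder (fun γ => w γ i) (b.αmax - b.α i) (b.limProfile q i)) ∧
    -- Cases 4 and 5: the best arm is the rarest but not uniquely, the second best arm is not
    (b.α 0 = b.αmax → b.α 1 < b.αmax → (∃ k, k ≠ 0 ∧ k ≠ 1 ∧ b.α k = b.αmax) →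
      ∀ ξ, b.IsXiZero ξ →
      -- Case 4
      (1 < b.ζ ξ →
        (∃! q, b.IsBalanced q) ∧ ∀ q, b.IsBalanced q → ∀ w, b.IsOptimalFamily w →
        ∀ i, RareBandit.HasOrder (fun γ => w γ i) (b.αmax - b.α i) (b.limProfile q i)) ∧
      -- Case 5
      (b.ζ ξ ≤ 1 → ∀ w, b.IsOptimalFamily w →
        (∀ i, i ≠ 1 →
          RareBandit.HasOrder (fun γ => w γ i) (b.αmax - b.α i) (b.limProfile ξ i)) ∧
        RareBandit.HasScaledLimit (fun γ => w γ 1) ((b.αmax - b.α 1) / 2) (b.limSecond ξ) ∧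
        (b.ζ ξ < 1 → RareBandit.HasOrder (fun γ => w γ 1) ((b.αmax - b.α 1) / 2)
          (b.limSecond ξ)))) := by
  have hbest' : ∀ i, i ≠ 0 → (b.arm i).mean < (b.arm 0).mean := hbest
  have hsecond' : ∀ i, i ≠ 0 → i ≠ 1 → (b.arm i).mean < (b.arm 1).mean := hsecond
  have h1 := hbest' 1 (by simp)
  choose! e he hsum using fun γ (hγ : 0 < γ) => RareBandit.exists_level hbest' hsecond' hγ
  have hopt : ∀ w, b.IsOptimalFamily w → ∀ᶠ γ in 𝓝[>] (0 : ℝ), w γ = b.levelWeights γ (e γ) := by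
    intro w hw
    filter_upwards [hw, self_mem_nhdsWithin] with γ hwγ hγ
    exact (RareBandit.isOptimal_iff hbest' hsecond' hγ (he γ hγ) (hsum γ hγ) _).1 hwγ
  have hxi := fun q => RareBandit.isXiZero_iff hbest' hsecond' (q := q)
  refine ⟨fun γ hγ => ⟨b.levelWeights γ (e γ), (RareBandit.isOptimal_iff hbest' hsecond' hγ
      (he γ hγ) (hsum γ hγ) _).2 rfl⟩, ?_, ⟨_, (hxi _).2 rfl, fun q hq => (hxi q).1 hq⟩,
    ?_, ?_, ?_, ?_⟩
  · refine ⟨fun i => if i = 0 then 0 else (b.arm i).tilt (b.mean 0), ⟨if_pos rfl, fun i hi => ?_⟩,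
      fun A hA => ?_⟩
    · dsimp only
      rw [if_neg hi]
      exact RareArm.isRaise_tilt (hbest' i hi).le
    · ext i
      split_ifs with hi
      · rw [hi, hA.1]
      · exact (hA.2 i hi).eq_tilt
  · intro hα A hA w hw
    exact RareBandit.hasOrder_of_not_rarest hbest' hsecond' he hsum hα (hopt w hw) hA
  · intro hα hlt ξ hξ w hw
    rw [(hxi ξ).1 hξ]
    have hemp : b.rarest = ∅ := Finset.eq_empty_of_forall_notMem fun i hi =>
      (hlt i (RareBandit.mem_rarest.1 hi).1).ne (RareBandit.mem_rarest.1 hi).2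
    have hζ : b.ζ (b.profileAt b.topLevel) = 0 := by
      rw [RareBandit.ζ, RareBandit.ratioSum, hemp, Finset.sum_empty]
    have := RareBandit.hasScaledLimit_of_ratioSum_le hbest' hsecond' he hα hsum (hopt w hw)
      (hlt 1 (by simp)) (hζ.trans_le zero_le_one)
    exact ⟨this.2.2 (hζ.trans_lt one_pos), this.1⟩
  · intro hα hα1 hlt
    have hsing : b.rarest = {1} := by
      ext i
      rw [RareBandit.mem_rarest, Finset.mem_singleton]
      constructor
      · rintro ⟨hi, hi'⟩
        by_contra hi1
        exact (hlt i hi hi1).ne hi'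
      · rintro rfl
        exact ⟨by simp, hα1⟩
    obtain ⟨e', he1, he'⟩ := ((RareArm.tendsto_ratioAt_atTop h1).eventually_ge_atTop 1).and
      (Ico_mem_nhdsLT (RareArm.maxLevel_pos h1)) |>.exists
    refine RareBandit.balanced_case hbest' hsecond' hα ?_ he' ?_
    · -- At `ξ` the divergence of the second best arm vanishes, and so does the quotient `h_1` by
      -- the convention on division by zero.
      rw [RareBandit.ratioSum_profileAt, hsing, Finset.sum_singleton, RareBandit.ratio,
        RareArm.ratioAt, RareBandit.topLevel, RareArm.lower_maxLevel h1, RareArm.divRatio,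
        RareArm.highDiv_maxLower h1, div_zero]
      exact zero_ne_one
    · rw [hsing, Finset.sum_singleton]
      exact he1
  · intro hα hα1 _ ξ hξ
    rw [(hxi ξ).1 hξ]
    refine ⟨fun hζ => ?_, fun hζ w hw => ?_⟩
    · have hcont : Tendsto (fun c => ∑ i ∈ b.rarest, b.ratio i c) (𝓝[<] b.topLevel)
          (𝓝 (∑ i ∈ b.rarest, b.ratio i b.topLevel)) := by
        refine tendsto_finsetSum _ fun i hi => ?_
        have hi0 := (RareBandit.mem_rarest.1 hi).1
        have hi1 : i ≠ 1 := fun h => hα1.ne (h ▸ (RareBandit.mem_rarest.1 hi).2)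
        have : ContinuousAt (b.ratio i) b.topLevel :=
          (RareArm.continuousOn_ratioAt (hbest' i hi0)).continuousAt
            (Ico_mem_nhds (RareArm.maxLevel_pos h1)
              (RareBandit.topLevel_lt hbest' hsecond' hi0 hi1))
        exact this.tendsto.mono_left nhdsWithin_le_nhds
      have hζ' := hζ
      rw [RareBandit.ζ, RareBandit.ratioSum_profileAt] at hζ'
      obtain ⟨e', he1, he'⟩ := (hcont.eventually (eventually_gt_nhds hζ')).and
        (Ico_mem_nhdsLT (RareArm.maxLevel_pos h1)) |>.exists
      exact RareBandit.balanced_case hbest' hsecond' hα hζ.ne' he' he1.le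
    · exact RareBandit.hasScaledLimit_of_ratioSum_le hbest' hsecond' he hα hsum (hopt w hw) hα1 hζ
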